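/- Let $R$ be a triangle (the tile) with angles $\alpha,\beta,\gamma$ opposite its sides $a,b,c$ respectively, where $\gamma=2\pi/3$, and suppose that $R$ has non-commensurable angles, i.e. not all of its angles are rational multiples of $\pi$. Let a triangle $ABC$ be tiled by $R$, i.e. $ABC$ is the union of finitely many congruent copies of $R$ (reflections allowed, not necessarily meeting edge to edge) with pairwise disjoint interiors; these copies are called tiles. Suppose that $ABC$ is not similar to $R$. Then $R$ has commensurable sides, i.e. the pairwise ratios of $a,b,c$ are all rational, unless both of the following conditions hold: (i) whenever a tile has an edge contained in a side of $ABC$, its $c$-edge (the edge of length $c$) is contained in that side; (ii) $ABC$ is either equilateral or has angles $\pi/3$, $2\alpha$, $2\beta$ (in some order). -/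

import Mathlib

open EuclideanGeometry

noncomputable section

namespace TriangleTiling

/-- The Euclidean plane. -/
abbrev Plane : Type := EuclideanSpace ℝ (Fin 2)

/-- A (nondegenerate) triangle in the plane, with vertices labelled `0, 1, 2`. -/
abbrev Tri : Type := Affine.Triangle ℝ Plane

/-- The `i`-th edge of a triangle: the closed segment opposite the vertex `i`. -/
def edge (t : Tri) (i : Fin 3) : Set Plane :=
  segment ℝ (t.points (i + 1)) (t.points (i + 2))

/-- The length of the `i`-th edge (opposite the vertex `i`). -/
def side (t : Tri) (i : Fin 3) : ℝ :=
  dist (t.points (i + 1)) (t.points (i + 2))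

/-- The interior angle at the vertex `i`, in radians. -/
def vertexAngle (t : Tri) (i : Fin 3) : ℝ :=
  ∠ (t.points (i + 1)) (t.points i) (t.points (i + 2))

/-- All angles are rational multiples of `π`. -/
def CommensurableAngles (t : Tri) : Prop :=
  ∀ i, ∃ q : ℚ, vertexAngle t i = q * Real.pi

/-- All pairwise ratios of the sides are rational. -/
def CommensurableSides (t : Tri) : Prop :=
  ∀ i j, ∃ q : ℚ, side t i / side t j = q

/-- Similarity of triangles as plane figures: some matching of the vertices is a similarity. -/
def IsSimilarTo (s t : Tri) : Prop :=
  ∃ σ : Equiv.Perm (Fin 3), Similar (s.points ∘ σ) t.points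

/-- `T` is a tiling of the triangle `ABC` by the tile `R`: finitely many congruent copies of `R`
(reflected copies are allowed), with pairwise disjoint interiors, whose union is `ABC`. The
vertices of each copy are labelled so as to correspond to those of `R`. The copies need not meet
edge to edge. -/
structure IsTiling (ABC R : Tri) {N : ℕ} (T : Fin N → Tri) : Prop where
  congruent : ∀ n, Congruent (T n).points R.points
  nonoverlapping : Pairwise fun m n => Disjoint (T m).interior (T n).interior
  union_eq : ⋃ n, (T n).closedInterior = ABC.closedInterior

/-- The tile `t` is supported by the segment `s`: one of its edges lies on `s`. -/
def SupportedBy (t : Tri) (s : Set Plane) : Prop :=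
  ∃ k, edge t k ⊆ s

/-- Every tile supported by the boundary of `ABC`, i.e. by a side of `ABC`, has its `c`-edge (the
edge opposite vertex `2`) on that side. -/
def BoundaryAllC (ABC : Tri) {N : ℕ} (T : Fin N → Tri) : Prop :=
  ∀ n j, SupportedBy (T n) (edge ABC j) → edge (T n) 2 ⊆ edge ABC j

/-- The angles of `t` are `x, y, z` in some order. -/
def HasAngles (t : Tri) (x y z : ℝ) : Prop :=
  ∃ σ : Equiv.Perm (Fin 3),
    vertexAngle t (σ 0) = x ∧ vertexAngle t (σ 1) = y ∧ vertexAngle t (σ 2) = z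

end TriangleTiling

end

/-!
Since `α` is not a rational multiple of `π`, while `α + β = π/3`, a sum of angles of the tile can
only be a straight or a full angle if it contains as many angles `α` as `β`. With `p` angles `α`,
`p` angles `β` and `r` angles `γ`, one has `p + 2r = 3` at a vertex in the relative interior of an
edge or of a side of `ABC`, and `p + 2r = 6` at the remaining vertices other than the corners of
`ABC`. The corners contain one angle of each kind altogether, in which case `ABC` is similar to the
tile, or else three angles `α` and three angles `β` (`IsTiling.corners_of_not_similar`). That the
angles of the tiles around a point add up (`IsTiling.sum_weight`) is seen by comparing areas inside
small discs.

A side of the tile is called *free* if a multiple of it can be written as a sum of sides in the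
trivial way only. If the sides are incommensurable, one of them is free (`exists_free`).

An edge of a tile, with a direction, is called a half-edge. In general, a half-edge `h` has a unique
partner: the half-edge of another tile beginning at the same point in the same direction. It is
unmatched if the two have different types, i.e. correspond to different sides of the tile. Suppose
that the type of an unmatched `h` is free, and follow the run of edges of this type that begins
with `h`, on the side of `h`. At the end of the run, the other side has an edge passing through
(`Chain.exists_crossing`); otherwise the edges on the other side would add up to a multiple of
the free side. So the end of the run is a *switch*: a point inside an edge, along which the type
changes from the free one to another. Since `h` can be recovered from the end of its run, there
are at most as many unmatched half-edges of the free type as switches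
(`IsTiling.card_unmatched_le`).

On the other hand, unmatched half-edges are forced by parity: the matched half-edges of one type
at a point come in pairs. An edge of type `a`, `b` or `c` ends at a given vertex for each angle
there other than the opposite one.

* If `a` or `b` is free, there is an unmatched half-edge of this type at each inner vertex with
  `(p, r) = (0, 3)` and at each switch with `(p, r) = (1, 1)`. So the former vertices are at most
  as many as the switches with `(p, r) = (3, 0)`. But the sum of `p - r` over all vertices is zero,
  with a contribution `3` from the corners of `ABC`, `-3` from the vertices with `(p, r) = (0, 3)`,
  `3` from those with `(p, r) = (3, 0)`, and none that is negative from the others. This is a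
  contradiction (`IsTiling.not_free`).
* If `c` is free, there is an unmatched half-edge of type `c` at each switch, since the number `2p`
  of half-edges of type `c` at such a point is even. Hence there are no unmatched half-edges of
  type `c` elsewhere, in particular none on the sides of `ABC`, along which therefore the type
  does not change between `c` and another one. Thus an edge on a side of `ABC` that is not of
  type `c`, and so has an angle `γ` at one end, is followed at this end by another such edge, whose
  angle `γ` is at its far end because `r ≤ 1`. As there are no angles `γ` in the corners, this is
  impossible (`IsTiling.boundary_type`). Finally, at a corner both sides of `ABC` begin with edges
  of type `c` and all other half-edges of type `c` are matched, so that the number of tiles there is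
  even. As it is six for the three corners together, there are two tiles in each, which gives the
  shape of `ABC` (`IsTiling.shape`).
-/

noncomputable section

namespace TriangleTiling

open MeasureTheory Set Filter Topology

variable {ABC R : Tri} {N : ℕ} {T : Fin N → Tri}

/-! ### Barycentric coordinates -/

/-- The vertices of a triangle, as an affine basis of the plane. -/
def basis (t : Tri) : AffineBasis (Fin 3) ℝ Plane :=
  ⟨t.points, t.independent,
    t.independent.affineSpan_eq_top_iff_card_eq_finrank_add_one.2 (by simp)⟩

/-- The barycentric coordinate with respect to the vertex `k`: the affine function that is `1` at
that vertex and vanishes on the opposite edge. -/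
def coord (t : Tri) (k : Fin 3) : Plane →ᵃ[ℝ] ℝ := (basis t).coord k

lemma coord_point (t : Tri) (i j : Fin 3) : coord t i (t.points j) = if i = j then 1 else 0 :=
  (basis t).coord_apply i j

lemma coord_self (t : Tri) (i : Fin 3) : coord t i (t.points i) = 1 := by simp [coord_point]

lemma coord_of_ne (t : Tri) {i j : Fin 3} (h : i ≠ j) : coord t i (t.points j) = 0 := by
  simp [coord_point, h]

lemma sum_coord (t : Tri) (Q : Plane) : ∑ k, coord t k Q = 1 :=
  (basis t).sum_coord_apply_eq_one Q

lemma coord_add (t : Tri) (k : Fin 3) (Q : Plane) :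
    coord t k Q + coord t (k + 1) Q + coord t (k + 2) Q = 1 := by
  have := sum_coord t Q
  rw [Fin.sum_univ_three] at this
  fin_cases k <;> simp <;> linarith

lemma ext_coord (t : Tri) {P Q : Plane} (h : ∀ k, coord t k P = coord t k Q) : P = Q :=
  (basis t).ext_elem h

lemma forall_fin_three (k : Fin 3) {p : Fin 3 → Prop} :
    (∀ i, p i) ↔ p k ∧ p (k + 1) ∧ p (k + 2) := by
  rw [Fin.forall_fin_succ, Fin.forall_fin_two]
  fin_cases k <;> simp <;> tauto

lemma continuous_coord (t : Tri) (k : Fin 3) : Continuous (coord t k) :=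
  (coord t k).continuous_of_finiteDimensional

lemma coord_lineMap (t : Tri) (k : Fin 3) (P Q : Plane) (s : ℝ) :
    coord t k (AffineMap.lineMap P Q s) = (1 - s) * coord t k P + s * coord t k Q := by
  rw [AffineMap.apply_lineMap, AffineMap.lineMap_apply_module]; simp

lemma coord_add_smul (t : Tri) (k : Fin 3) (P v : Plane) (s : ℝ) :
    coord t k (P + s • v) = coord t k P + s * (coord t k).linear v := by
  have := (coord t k).map_vadd P (s • v)
  simp only [vadd_eq_add, map_smul, smul_eq_mul] at this
  rw [add_comm P, this, add_comm]

lemma coord_linear_sub (t : Tri) (k : Fin 3) (P Q : Plane) :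
    (coord t k).linear (Q - P) = coord t k Q - coord t k P := by
  have := (coord t k).linearMap_vsub Q P
  simpa using this

lemma mem_closedInterior_iff (t : Tri) (Q : Plane) :
    Q ∈ t.closedInterior ↔ ∀ k, 0 ≤ coord t k Q := by
  rw [← Affine.Simplex.convexHull_eq_closedInterior]
  have := (basis t).convexHull_eq_nonneg_coord
  exact Set.ext_iff.1 this Q

lemma interior_eq (t : Tri) : t.interior = interior t.closedInterior := by
  rw [← Affine.Simplex.convexHull_eq_closedInterior]
  have h := (basis t).interior_convexHull
  change interior (convexHull ℝ (Set.range t.points)) = _ at h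
  rw [h]
  ext Q
  have hQ : Finset.univ.affineCombination ℝ t.points (fun k => coord t k Q) = Q :=
    (basis t).affineCombination_coord_eq_self Q
  have h1 := t.affineCombination_mem_interior_iff (w := fun k => coord t k Q) (sum_coord t Q)
  rw [hQ] at h1
  rw [h1]
  constructor
  · intro h i; exact (h i).1
  · intro h i
    refine ⟨h i, ?_⟩
    have h2 := coord_add t i Q
    have h3 : 0 < coord t (i + 1) Q := h _
    have h4 : 0 < coord t (i + 2) Q := h _
    linarith

lemma mem_interior_iff (t : Tri) (Q : Plane) :
    Q ∈ t.interior ↔ ∀ k, 0 < coord t k Q := by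
  rw [interior_eq, ← Affine.Simplex.convexHull_eq_closedInterior]
  have := (basis t).interior_convexHull
  exact Set.ext_iff.1 this Q

/-- `Q` lies in the relative interior of the edge opposite the vertex `k`. -/
def OnEdge (t : Tri) (k : Fin 3) (Q : Plane) : Prop :=
  coord t k Q = 0 ∧ 0 < coord t (k + 1) Q ∧ 0 < coord t (k + 2) Q

lemma eq_point_of_coord_eq_zero (t : Tri) (i : Fin 3) {Q : Plane} (h1 : coord t (i + 1) Q = 0)
    (h2 : coord t (i + 2) Q = 0) : Q = t.points i := by
  apply ext_coord t
  rw [forall_fin_three i]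
  have := coord_add t i Q
  refine ⟨?_, ?_, ?_⟩
  · rw [coord_self]; linarith
  · rw [coord_of_ne _ (by simp), h1]
  · rw [coord_of_ne _ (by simp), h2]

lemma points_ne (t : Tri) {i j : Fin 3} (h : i ≠ j) : t.points i ≠ t.points j :=
  fun e => h (t.independent.injective e)

lemma OnEdge.ne_point {t : Tri} {k : Fin 3} {Q : Plane} (h : OnEdge t k Q) (i : Fin 3) :
    Q ≠ t.points i := by
  rintro rfl
  obtain ⟨h0, h1, h2⟩ := h
  simp only [coord_point] at h0 h1 h2
  fin_cases k <;> fin_cases i <;> simp_all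

lemma OnEdge.unique {t : Tri} {k k' : Fin 3} {Q : Plane} (h : OnEdge t k Q) (h' : OnEdge t k' Q) :
    k = k' := by
  obtain ⟨h0, h1, h2⟩ := h
  obtain ⟨h0', h1', h2'⟩ := h'
  fin_cases k <;> fin_cases k' <;> simp_all

/-- A point of a triangle is an interior point, a relative interior point of an edge, or a
vertex. -/
lemma cases_of_mem_closedInterior {t : Tri} {Q : Plane} (h : Q ∈ t.closedInterior) :
    Q ∈ t.interior ∨ (∃ k, OnEdge t k Q) ∨ ∃ i, Q = t.points i := by
  rw [mem_closedInterior_iff] at h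
  by_cases hi : Q ∈ t.interior
  · exact Or.inl hi
  right
  rw [mem_interior_iff] at hi
  push Not at hi
  obtain ⟨k, hk⟩ := hi
  have hk0 : coord t k Q = 0 := le_antisymm hk (h k)
  rcases (h (k + 1)).eq_or_lt with h1 | h1
  · right
    refine ⟨k + 2, eq_point_of_coord_eq_zero t _ ?_ ?_⟩
    · rw [show k + 2 + 1 = k by fin_cases k <;> rfl, hk0]
    · rw [show k + 2 + 2 = k + 1 by fin_cases k <;> rfl, ← h1]
  rcases (h (k + 2)).eq_or_lt with h2 | h2
  · right
    refine ⟨k + 1, eq_point_of_coord_eq_zero t _ ?_ ?_⟩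
    · rw [show k + 1 + 1 = k + 2 by fin_cases k <;> rfl, ← h2]
    · rw [show k + 1 + 2 = k by fin_cases k <;> rfl, hk0]
  · exact Or.inl ⟨k, hk0, h1, h2⟩

/-- A point of the line through an edge is determined by one of its coordinates. -/
lemma eq_of_coord_eq_zero (t : Tri) (k : Fin 3) {Q : Plane} (h : coord t k Q = 0) :
    Q = t.points (k + 1) + coord t (k + 2) Q • (t.points (k + 2) - t.points (k + 1)) := by
  apply ext_coord t
  rw [forall_fin_three k]
  have := coord_add t k Q
  simp only [coord_add_smul, coord_linear_sub]
  have e1 : coord t k (t.points (k + 1)) = 0 := coord_of_ne _ (by simp)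
  have e2 : coord t k (t.points (k + 2)) = 0 := coord_of_ne _ (by simp)
  have e3 : coord t (k + 1) (t.points (k + 2)) = 0 := coord_of_ne _ (by simp)
  have e4 : coord t (k + 2) (t.points (k + 1)) = 0 := coord_of_ne _ (by simp)
  rw [e1, e2, e3, e4, coord_self, coord_self, h]
  refine ⟨by ring, by linarith, by ring⟩

lemma edge_subset_iff (t : Tri) (k : Fin 3) (S : Tri) (j : Fin 3) :
    edge t k ⊆ edge S j ↔
      t.points (k + 1) ∈ edge S j ∧ t.points (k + 2) ∈ edge S j := by
  constructor
  · intro h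
    exact ⟨h (left_mem_segment ℝ _ _), h (right_mem_segment ℝ _ _)⟩
  · rintro ⟨h1, h2⟩
    exact (convex_segment _ _).segment_subset h1 h2

lemma mem_edge_iff (t : Tri) (k : Fin 3) (Q : Plane) :
    Q ∈ edge t k ↔ coord t k Q = 0 ∧ 0 ≤ coord t (k + 1) Q ∧ 0 ≤ coord t (k + 2) Q := by
  unfold edge
  rw [segment_eq_image_lineMap]
  have e1 : coord t k (t.points (k + 1)) = 0 := coord_of_ne _ (by simp)
  have e2 : coord t k (t.points (k + 2)) = 0 := coord_of_ne _ (by simp)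
  have e3 : coord t (k + 1) (t.points (k + 2)) = 0 := coord_of_ne _ (by simp)
  have e4 : coord t (k + 2) (t.points (k + 1)) = 0 := coord_of_ne _ (by simp)
  constructor
  · rintro ⟨s, ⟨hs0, hs1⟩, rfl⟩
    simp only [coord_lineMap, e1, e2, e3, e4, coord_self]
    refine ⟨by ring, by linarith, by linarith⟩
  · rintro ⟨h0, h1, h2⟩
    have := coord_add t k Q
    refine ⟨coord t (k + 2) Q, ⟨h2, by linarith⟩, ?_⟩
    conv_rhs => rw [eq_of_coord_eq_zero t k h0]
    rw [AffineMap.lineMap_apply, vadd_eq_add, vsub_eq_sub, add_comm]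

/-! ### Areas of circular sectors -/

/-- Area of the circular sector spanned by the positive real axis and a complex number `q` of the
upper half-plane. The two inequalities say that `z` lies to the left of `1` and to the right
of `q`. -/
lemma volume_complex_sector {q : ℂ} (hq : 0 < q.im) {r : ℝ} (hr : 0 < r) :
    volume ({z : ℂ | 0 ≤ z.im ∧ 0 ≤ q.im * z.re - q.re * z.im} ∩ Metric.ball 0 r) =
      ENNReal.ofReal (q.arg * r ^ 2 / 2) := by
  set A := {z : ℂ | 0 ≤ z.im ∧ 0 ≤ q.im * z.re - q.re * z.im} ∩ Metric.ball 0 r with hA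
  have hq0 : q ≠ 0 := by rintro rfl; simp at hq
  have hqn : 0 < ‖q‖ := norm_pos_iff.2 hq0
  have harg0 : 0 < q.arg := by
    rcases (Complex.arg_nonneg_iff.2 hq.le).eq_or_lt with h | h
    · have := Complex.arg_eq_zero_iff.1 h.symm
      linarith [this.2]
    · exact h
  have hargpi : q.arg < Real.pi := by
    rcases (Complex.arg_le_pi q).eq_or_lt with h | h
    · have := Complex.arg_eq_pi_iff.1 h
      linarith [this.2]
    · exact h
  have hAm : MeasurableSet A := by
    apply MeasurableSet.inter _ measurableSet_ball
    apply MeasurableSet.inter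
    · exact (isClosed_le continuous_const Complex.continuous_im).measurableSet
    · exact (isClosed_le continuous_const ((continuous_const.mul Complex.continuous_re).sub
        (continuous_const.mul Complex.continuous_im))).measurableSet
  rw [← lintegral_indicator_one hAm, ← Complex.lintegral_comp_polarCoord_symm]
  have hmem : ∀ p ∈ polarCoord.target, (Complex.polarCoord.symm p ∈ A ↔
      p ∈ Ioo 0 r ×ˢ Icc 0 q.arg) := by
    rintro ⟨ρ, θ⟩ hp
    simp only [polarCoord_target, mem_prod, mem_Ioi, mem_Ioo] at hp
    obtain ⟨hρ, hθ1, hθ2⟩ := hp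
    have hre : (Complex.polarCoord.symm (ρ, θ)).re = ρ * Real.cos θ := by
      simp [Complex.polarCoord_symm_apply, Complex.cos_ofReal_re]
    have him : (Complex.polarCoord.symm (ρ, θ)).im = ρ * Real.sin θ := by
      simp [Complex.polarCoord_symm_apply, Complex.sin_ofReal_re]
    have hn : ‖Complex.polarCoord.symm (ρ, θ)‖ = ρ := by
      rw [Complex.norm_polarCoord_symm]; exact abs_of_pos hρ
    have hqre : q.re = ‖q‖ * Real.cos q.arg := by
      rw [Complex.cos_arg hq0]; field_simp
    have hqim : q.im = ‖q‖ * Real.sin q.arg := by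
      rw [Complex.sin_arg]; field_simp
    simp only [hA, mem_inter_iff, mem_ofPred_eq, hre, him, mem_ball_zero_iff, hn, mem_prod,
      mem_Ioo, mem_Icc]
    have key : q.im * (ρ * Real.cos θ) - q.re * (ρ * Real.sin θ)
        = ‖q‖ * ρ * Real.sin (q.arg - θ) := by
      rw [Real.sin_sub]
      conv_lhs => rw [hqre, hqim]
      ring
    rw [key, mul_nonneg_iff_of_pos_left hρ, mul_nonneg_iff_of_pos_left (by positivity)]
    constructor
    · rintro ⟨⟨h1, h2⟩, h3⟩
      have hθ0 : 0 ≤ θ := by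
        by_contra hneg
        exact absurd (Real.sin_neg_of_neg_of_neg_pi_lt (not_le.1 hneg) hθ1) (not_lt.2 h1)
      refine ⟨⟨hρ, h3⟩, hθ0, ?_⟩
      by_contra hneg
      exact absurd (Real.sin_neg_of_neg_of_neg_pi_lt (by linarith [not_le.1 hneg])
        (by linarith)) (not_lt.2 h2)
    · rintro ⟨⟨-, h3⟩, h4, h5⟩
      exact ⟨⟨Real.sin_nonneg_of_nonneg_of_le_pi h4 hθ2.le,
        Real.sin_nonneg_of_nonneg_of_le_pi (by linarith) (by linarith)⟩, h3⟩
  have hmeas : MeasurableSet (Ioo 0 r ×ˢ Icc 0 q.arg : Set (ℝ × ℝ)) :=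
    measurableSet_Ioo.prod measurableSet_Icc
  have hsub : (Ioo 0 r ×ˢ Icc 0 q.arg : Set (ℝ × ℝ)) ⊆ polarCoord.target := by
    rintro ⟨ρ, θ⟩ ⟨⟨h1, h2⟩, h3, h4⟩
    simp only [polarCoord_target, mem_prod, mem_Ioi, mem_Ioo]
    simp only at h1 h2 h3 h4
    exact ⟨h1, by linarith [Real.pi_pos], by linarith⟩
  calc ∫⁻ p in polarCoord.target, ENNReal.ofReal p.1 • A.indicator 1 (Complex.polarCoord.symm p)
      = ∫⁻ p in polarCoord.target,
          (Ioo 0 r ×ˢ Icc 0 q.arg : Set (ℝ × ℝ)).indicator (fun p => ENNReal.ofReal p.1) p := by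
        apply setLIntegral_congr_fun polarCoord.open_target.measurableSet
        intro p hp
        have := hmem p hp
        by_cases h : Complex.polarCoord.symm p ∈ A
        · simp only [indicator_of_mem h, indicator_of_mem (this.1 h)]; simp
        · simp only [indicator_of_notMem h, indicator_of_notMem (fun h' => h (this.2 h'))]; simp
    _ = ∫⁻ p in (Ioo 0 r ×ˢ Icc 0 q.arg : Set (ℝ × ℝ)), ENNReal.ofReal p.1 := by
        rw [lintegral_indicator hmeas, Measure.restrict_restrict hmeas,
          inter_eq_self_of_subset_left hsub]
    _ = (∫⁻ ρ in Ioo 0 r, ENNReal.ofReal ρ) * ENNReal.ofReal q.arg := by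
        rw [Measure.volume_eq_prod, ← Measure.prod_restrict, lintegral_prod _ (by fun_prop)]
        simp [lintegral_mul_const, ENNReal.measurable_ofReal]
    _ = ENNReal.ofReal (r ^ 2 / 2) * ENNReal.ofReal q.arg := by
        congr 1
        rw [← ofReal_integral_eq_lintegral_ofReal]
        · rw [← integral_Ioc_eq_integral_Ioo, ← intervalIntegral.integral_of_le hr.le]
          simp
        · exact (continuous_id.integrableOn_Icc).mono_set Ioo_subset_Icc_self
        · exact (ae_restrict_mem measurableSet_Ioo).mono fun x hx => hx.1.le
    _ = ENNReal.ofReal (q.arg * r ^ 2 / 2) := by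
        rw [← ENNReal.ofReal_mul (by positivity)]
        congr 1; ring

/-- Any two linearly independent vectors can be moved isometrically to the complex plane so that
the first becomes a positive real and the second lies in the upper half-plane. -/
lemma exists_isometry_complex {x y : Plane} (hx : x ≠ 0) (hy : ∀ s : ℝ, y ≠ s • x) :
    ∃ e : Plane ≃ₗᵢ[ℝ] ℂ, ∃ m : ℝ, 0 < m ∧ e x = m ∧ 0 < (e y).im := by
  set e₀ : Plane ≃ₗᵢ[ℝ] ℂ := Complex.orthonormalBasisOneI.repr.symm with he₀
  have hx0 : e₀ x ≠ 0 := by simpa using hx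
  have hn : 0 < ‖e₀ x‖ := norm_pos_iff.2 hx0
  let c : Circle := ⟨(starRingEnd ℂ (e₀ x)) / ‖e₀ x‖, by
    change _ ∈ Metric.sphere (0 : ℂ) 1
    simp [hx]⟩
  have h1 : (e₀.trans (rotation c)) x = (‖e₀ x‖ : ℂ) := by
    rw [LinearIsometryEquiv.trans_apply, rotation_apply]
    simp only [c]
    have : (starRingEnd ℂ (e₀ x)) * e₀ x = (‖e₀ x‖ : ℂ) ^ 2 := Complex.conj_mul' _
    rw [div_mul_eq_mul_div, this]
    have : (‖e₀ x‖ : ℂ) ≠ 0 := by exact_mod_cast hn.ne'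
    field_simp
  have h2 : ((e₀.trans (rotation c)) y).im ≠ 0 := by
    intro h
    set w := (e₀.trans (rotation c)) y with hw
    apply hy (w.re / ‖e₀ x‖)
    apply (e₀.trans (rotation c)).injective
    rw [map_smul, h1, ← hw]
    apply Complex.ext
    · simp; field_simp
    · simp [h]
  rcases lt_or_gt_of_ne h2 with h | h
  · refine ⟨(e₀.trans (rotation c)).trans Complex.conjLIE, ‖e₀ x‖, hn, ?_, ?_⟩
    · rw [LinearIsometryEquiv.trans_apply, h1]; simp
    · change 0 < (starRingEnd ℂ ((e₀.trans (rotation c)) y)).im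
      rw [Complex.conj_im]; linarith
  · exact ⟨_, _, hn, h1, h⟩

/-- The weight of a point `Q` with respect to a triangle: the angle, in radians, that the triangle
fills around `Q`. -/
def weight (t : Tri) (Q : Plane) : ℝ :=
  open Classical in
  (if Q ∈ t.interior then 2 * Real.pi else 0) + (∑ k, if OnEdge t k Q then Real.pi else 0) +
    ∑ i, if Q = t.points i then vertexAngle t i else 0

lemma sub_eq_coord (t : Tri) (i : Fin 3) (Q : Plane) :
    Q - t.points i = coord t (i + 1) Q • (t.points (i + 1) - t.points i) +
      coord t (i + 2) Q • (t.points (i + 2) - t.points i) := by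
  have h : Q = t.points i + (coord t (i + 1) Q • (t.points (i + 1) - t.points i) +
      coord t (i + 2) Q • (t.points (i + 2) - t.points i)) := by
    apply ext_coord t
    rw [forall_fin_three i]
    have := coord_add t i Q
    simp only [← add_assoc, coord_add_smul, coord_linear_sub]
    have h12 : i + 1 ≠ i + 2 := by simp
    have e1 : coord t i (t.points (i + 1)) = 0 := coord_of_ne _ (by simp)
    have e2 : coord t i (t.points (i + 2)) = 0 := coord_of_ne _ (by simp)
    have e3 : coord t (i + 1) (t.points (i + 2)) = 0 := coord_of_ne _ h12
    have e4 : coord t (i + 2) (t.points (i + 1)) = 0 := coord_of_ne _ h12.symm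
    have e5 : coord t (i + 1) (t.points i) = 0 := coord_of_ne _ (by simp)
    have e6 : coord t (i + 2) (t.points i) = 0 := coord_of_ne _ (by simp)
    rw [e1, e2, e3, e4, e5, e6, coord_self, coord_self, coord_self]
    refine ⟨by linarith, by ring, by ring⟩
  rw [sub_eq_iff_eq_add']
  exact h

lemma edge_vectors_independent (t : Tri) (i : Fin 3) (s : ℝ) :
    t.points (i + 2) - t.points i ≠ s • (t.points (i + 1) - t.points i) := by
  intro h
  have h1 : t.points (i + 2) = t.points i + s • (t.points (i + 1) - t.points i) :=
    eq_add_of_sub_eq' h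
  have h2 := coord_self t (i + 2)
  rw [h1, coord_add_smul, coord_linear_sub, coord_of_ne _ (by simp), coord_of_ne _ (by simp)] at h2
  simp at h2

lemma volume_vertex_sector (t : Tri) (i : Fin 3) {r : ℝ} (hr : 0 < r) :
    volume ({Q | 0 ≤ coord t (i + 1) Q ∧ 0 ≤ coord t (i + 2) Q} ∩ Metric.ball (t.points i) r) =
      ENNReal.ofReal (vertexAngle t i * r ^ 2 / 2) := by
  have hx : t.points (i + 1) - t.points i ≠ 0 := sub_ne_zero.2 (points_ne t (by simp))
  obtain ⟨e, m, hm, he, hy⟩ := exists_isometry_complex hx (edge_vectors_independent t i)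
  set q := e (t.points (i + 2) - t.points i) with hq
  have hq0 : q ≠ 0 := by rintro h; rw [h] at hy; simp at hy
  have hang : vertexAngle t i = q.arg := by
    unfold vertexAngle EuclideanGeometry.angle
    rw [vsub_eq_sub, vsub_eq_sub, ← LinearIsometry.angle_map e.toLinearIsometry]
    simp only [LinearIsometryEquiv.coe_toLinearIsometry]
    rw [← hq, he, InnerProductGeometry.angle_comm,
      Complex.angle_eq_abs_arg hq0 (by exact_mod_cast hm.ne')]
    rw [div_eq_inv_mul, ← Complex.ofReal_inv, Complex.arg_real_mul _ (inv_pos.2 hm),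
      abs_of_nonneg (Complex.arg_nonneg_iff.2 hy.le)]
  have hmp : MeasurePreserving (fun Q => e (Q - t.points i)) (volume : Measure Plane) volume :=
    e.measurePreserving.comp (measurePreserving_sub_right volume (t.points i))
  have hpre : {Q | 0 ≤ coord t (i + 1) Q ∧ 0 ≤ coord t (i + 2) Q} ∩ Metric.ball (t.points i) r =
      (fun Q => e (Q - t.points i)) ⁻¹'
        ({z : ℂ | 0 ≤ z.im ∧ 0 ≤ q.im * z.re - q.re * z.im} ∩ Metric.ball 0 r) := by
    ext Q
    have h1 : e (Q - t.points i) = coord t (i + 1) Q • (m : ℂ) + coord t (i + 2) Q • q := by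
      rw [sub_eq_coord t i Q, map_add, map_smul, map_smul, he, ← hq]
    have h2 : (e (Q - t.points i)).im = q.im * coord t (i + 2) Q := by rw [h1]; simp [mul_comm]
    have h3 : (e (Q - t.points i)).re = coord t (i + 1) Q * m + coord t (i + 2) Q * q.re := by
      rw [h1]; simp
    simp only [mem_inter_iff, mem_ofPred_eq, mem_preimage, mem_ball_iff_norm, sub_zero, e.norm_map]
    rw [h3, h2, show q.im * (coord t (i + 1) Q * m + coord t (i + 2) Q * q.re) -
      q.re * (q.im * coord t (i + 2) Q) = (q.im * m) * coord t (i + 1) Q by ring,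
      mul_nonneg_iff_of_pos_left hy, mul_nonneg_iff_of_pos_left (by positivity)]
    tauto
  have hmeas : MeasurableSet ({z : ℂ | 0 ≤ z.im ∧ 0 ≤ q.im * z.re - q.re * z.im} ∩
      Metric.ball 0 r) := by
    refine (MeasurableSet.inter ?_ ?_).inter measurableSet_ball
    · exact (isClosed_le continuous_const Complex.continuous_im).measurableSet
    · exact (isClosed_le continuous_const ((continuous_const.mul Complex.continuous_re).sub
        (continuous_const.mul Complex.continuous_im))).measurableSet
  rw [hpre, hmp.measure_preimage hmeas.nullMeasurableSet, volume_complex_sector hy hr, hang]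

lemma volume_ball_plane (Q : Plane) (r : ℝ) (hr : 0 < r) :
    volume (Metric.ball Q r) = ENNReal.ofReal (Real.pi * r ^ 2) := by
  rw [EuclideanSpace.volume_ball_fin_two, ← ENNReal.ofReal_pow hr.le, mul_comm,
    ENNReal.ofReal_mul Real.pi_pos.le]

lemma coord_linear_ne_zero (t : Tri) (k : Fin 3) : (coord t k).linear ≠ 0 := by
  intro h
  have := coord_linear_sub t k (t.points (k + 1)) (t.points k)
  rw [h, coord_self, coord_of_ne _ (by simp)] at this
  simp at this

lemma volume_half_ball (t : Tri) (k : Fin 3) {Q : Plane} (hQ : coord t k Q = 0) {r : ℝ}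
    (hr : 0 < r) : volume ({P | 0 ≤ coord t k P} ∩ Metric.ball Q r) =
      ENNReal.ofReal (Real.pi * r ^ 2 / 2) := by
  set A := {P | 0 ≤ coord t k P} ∩ Metric.ball Q r
  set B := {P | coord t k P ≤ 0} ∩ Metric.ball Q r
  have hA : MeasurableSet A :=
    (isClosed_le continuous_const (continuous_coord t k)).measurableSet.inter measurableSet_ball
  have hB : MeasurableSet B :=
    (isClosed_le (continuous_coord t k) continuous_const).measurableSet.inter measurableSet_ball
  have hcoord : ∀ P, coord t k (Q + Q - P) = - coord t k P := by
    intro P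
    have h := coord_add_smul t k Q (Q - P) 1
    rw [one_smul, coord_linear_sub, hQ, show Q + (Q - P) = Q + Q - P by abel] at h
    rw [h]; ring
  have hmp : MeasurePreserving (fun P => Q + Q - P) (volume : Measure Plane) volume :=
    Measure.measurePreserving_sub_left volume (Q + Q)
  have hAB : volume B = volume A := by
    rw [← hmp.measure_preimage hA.nullMeasurableSet]
    congr 1
    ext P
    simp only [A, B, mem_inter_iff, mem_preimage, mem_ofPred_eq, hcoord, Metric.mem_ball,
      dist_eq_norm]
    rw [show Q + Q - P - Q = -(P - Q) by abel, norm_neg, neg_nonneg]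
  have hunion : A ∪ B = Metric.ball Q r := by
    rw [← union_inter_distrib_right]
    apply inter_eq_right.2
    intro P _
    exact le_total (0 : ℝ) (coord t k P)
  have hnull : volume (A ∩ B) = 0 := by
    refine measure_mono_null ?_ (Measure.addHaar_affineSubspace volume
      (AffineSubspace.comap (coord t k) (AffineSubspace.mk' 0 ⊥)) ?_)
    · rintro P ⟨⟨h1, -⟩, h2, -⟩
      simp only [mem_ofPred_eq] at h1 h2
      simp [le_antisymm h2 h1]
    · intro h
      have : t.points k ∈ (AffineSubspace.comap (coord t k) (AffineSubspace.mk' (0 : ℝ) ⊥)) := by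
        rw [h]; trivial
      simp [coord_self] at this
  have hsum := measure_union_add_inter A hB (μ := volume)
  rw [hunion, hnull, hAB, add_zero, volume_ball_plane Q r hr] at hsum
  have h2 : ENNReal.ofReal (Real.pi * r ^ 2) = ENNReal.ofReal (Real.pi * r ^ 2 / 2) +
      ENNReal.ofReal (Real.pi * r ^ 2 / 2) := by
    rw [← ENNReal.ofReal_add (by positivity) (by positivity)]; congr 1; ring
  rw [h2, ← two_mul, ← two_mul] at hsum
  exact ((ENNReal.mul_right_inj (by norm_num) (by norm_num)).1 hsum).symm

/-! ### The tiles fill up the angle around each point -/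

/-- Near a point, the barycentric coordinates keep the signs they have there. -/
lemma exists_ball_sign (t : Tri) (Q : Plane) : ∃ δ > 0, ∀ P ∈ Metric.ball Q δ, ∀ k,
    (0 < coord t k Q → 0 < coord t k P) ∧ (coord t k Q < 0 → coord t k P < 0) := by
  have h : ∀ᶠ P in 𝓝 Q, ∀ k,
      (0 < coord t k Q → 0 < coord t k P) ∧ (coord t k Q < 0 → coord t k P < 0) := by
    rw [eventually_all]
    intro k
    have hc := (continuous_coord t k).continuousAt (x := Q)
    refine Eventually.and ?_ ?_
    · by_cases h : 0 < coord t k Q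
      · filter_upwards [hc.eventually (lt_mem_nhds h)] with P hP _ using hP
      · exact Eventually.of_forall fun P hP => absurd hP h
    · by_cases h : coord t k Q < 0
      · filter_upwards [hc.eventually (gt_mem_nhds h)] with P hP _ using hP
      · exact Eventually.of_forall fun P hP => absurd hP h
  obtain ⟨δ, hδ, h⟩ := Metric.eventually_nhds_iff_ball.1 h
  exact ⟨δ, hδ, h⟩

lemma not_mem_interior_point (t : Tri) (i : Fin 3) : t.points i ∉ t.interior := by
  rw [mem_interior_iff]
  intro h
  have := h (i + 1)
  rw [coord_of_ne _ (by simp)] at this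
  exact lt_irrefl _ this

lemma OnEdge.not_mem_interior {t : Tri} {k : Fin 3} {Q : Plane} (h : OnEdge t k Q) :
    Q ∉ t.interior := by
  rw [mem_interior_iff]
  intro h'
  exact absurd h.1 (h' k).ne'

lemma weight_of_mem_interior {t : Tri} {Q : Plane} (h : Q ∈ t.interior) :
    weight t Q = 2 * Real.pi := by
  have h1 : ∀ k, ¬ OnEdge t k Q := fun k hk => hk.not_mem_interior h
  have h2 : ∀ i, Q ≠ t.points i := by
    rintro i rfl
    exact not_mem_interior_point t i h
  simp [weight, h, h1, h2]

lemma weight_of_onEdge {t : Tri} {k : Fin 3} {Q : Plane} (h : OnEdge t k Q) :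
    weight t Q = Real.pi := by
  have h1 : ∀ k', OnEdge t k' Q ↔ k' = k :=
    fun k' => ⟨fun hk' => hk'.unique h, fun e => e ▸ h⟩
  simp [weight, h.not_mem_interior, h1, h.ne_point]

lemma weight_point (t : Tri) (i : Fin 3) : weight t (t.points i) = vertexAngle t i := by
  have h1 : ∀ k, ¬ OnEdge t k (t.points i) := fun k hk => hk.ne_point i rfl
  have h2 : ∀ j, t.points i = t.points j ↔ i = j := fun j => t.independent.injective.eq_iff
  simp [weight, not_mem_interior_point, h1, h2]

lemma OnEdge.mem_closedInterior {t : Tri} {k : Fin 3} {Q : Plane} (h : OnEdge t k Q) :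
    Q ∈ t.closedInterior := by
  rw [mem_closedInterior_iff, forall_fin_three k]
  exact ⟨h.1.ge, h.2.1.le, h.2.2.le⟩

lemma weight_of_notMem {t : Tri} {Q : Plane} (h : Q ∉ t.closedInterior) : weight t Q = 0 := by
  have h0 : Q ∉ t.interior := fun h' => h (t.interior_subset_closedInterior h')
  have h1 : ∀ k, ¬ OnEdge t k Q := fun k hk => h hk.mem_closedInterior
  have h2 : ∀ i, Q ≠ t.points i := by
    rintro i rfl
    exact h (t.point_mem_closedInterior i)
  simp [weight, h0, h1, h2]

/-- Around a point, a triangle looks like a circular sector of angle `weight t Q`. -/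
lemma volume_inter_ball (t : Tri) (Q : Plane) : ∀ᶠ r in 𝓝[>] (0 : ℝ),
    volume (t.closedInterior ∩ Metric.ball Q r) = ENNReal.ofReal (weight t Q * r ^ 2 / 2) := by
  obtain ⟨δ, hδ, hs⟩ := exists_ball_sign t Q
  filter_upwards [Ioo_mem_nhdsGT hδ] with r ⟨hr, hrδ⟩
  replace hs := fun P hP => hs P (Metric.ball_subset_ball hrδ.le hP)
  by_cases hQ : Q ∈ t.closedInterior
  · rcases cases_of_mem_closedInterior hQ with h | ⟨k, h⟩ | ⟨i, rfl⟩
    · rw [weight_of_mem_interior h, inter_eq_right.2, volume_ball_plane Q r hr]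
      · congr 1; ring
      · intro P hP
        rw [mem_closedInterior_iff]
        rw [mem_interior_iff] at h
        exact fun k => ((hs P hP k).1 (h k)).le
    · rw [weight_of_onEdge h, ← volume_half_ball t k h.1 hr]
      congr 1
      ext P
      simp only [mem_inter_iff, mem_ofPred_eq, mem_closedInterior_iff]
      constructor
      · rintro ⟨h1, h2⟩; exact ⟨h1 k, h2⟩
      · rintro ⟨h1, h2⟩
        refine ⟨?_, h2⟩
        rw [forall_fin_three k]
        exact ⟨h1, ((hs P h2 _).1 h.2.1).le, ((hs P h2 _).1 h.2.2).le⟩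
    · rw [weight_point, ← volume_vertex_sector t i hr]
      congr 1
      ext P
      simp only [mem_inter_iff, mem_ofPred_eq, mem_closedInterior_iff]
      constructor
      · rintro ⟨h1, h2⟩; exact ⟨⟨h1 _, h1 _⟩, h2⟩
      · rintro ⟨h1, h2⟩
        refine ⟨?_, h2⟩
        rw [forall_fin_three i]
        refine ⟨((hs P h2 _).1 ?_).le, h1⟩
        rw [coord_self]; norm_num
  · rw [weight_of_notMem hQ]
    have : t.closedInterior ∩ Metric.ball Q r = ∅ := by
      rw [← disjoint_iff_inter_eq_empty, disjoint_right]
      intro P hP hP'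
      rw [mem_closedInterior_iff] at hQ hP'
      push Not at hQ
      obtain ⟨k, hk⟩ := hQ
      exact absurd ((hs P hP k).2 hk) (not_lt.2 (hP' k))
    simp [this]

lemma weight_nonneg (t : Tri) (Q : Plane) : 0 ≤ weight t Q := by
  unfold weight
  have : ∀ i, 0 ≤ vertexAngle t i := fun i => InnerProductGeometry.angle_nonneg _ _
  have := Real.pi_pos
  refine add_nonneg (add_nonneg ?_ (Finset.sum_nonneg fun k _ => ?_))
    (Finset.sum_nonneg fun i _ => ?_) <;> split_ifs <;> first | positivity | simp_all

lemma IsTiling.subset (hT : IsTiling ABC R T) (n : Fin N) :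
    (T n).closedInterior ⊆ ABC.closedInterior := by
  rw [← hT.union_eq]; exact subset_iUnion (fun n => (T n).closedInterior) n

/-- The tiles fill up the angle of `ABC` around each point. -/
theorem IsTiling.sum_weight (hT : IsTiling ABC R T) (Q : Plane) :
    ∑ n, weight (T n) Q = weight ABC Q := by
  have hev : ∀ᶠ r in 𝓝[>] (0 : ℝ),
      (∀ n, volume ((T n).closedInterior ∩ Metric.ball Q r) =
        ENNReal.ofReal (weight (T n) Q * r ^ 2 / 2)) ∧
      volume (ABC.closedInterior ∩ Metric.ball Q r) =
        ENNReal.ofReal (weight ABC Q * r ^ 2 / 2) ∧ 0 < r := by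
    refine Eventually.and (eventually_all.2 fun n => volume_inter_ball _ _)
      ((volume_inter_ball _ _).and self_mem_nhdsWithin)
  obtain ⟨r, h1, h2, hr⟩ := hev.exists
  have hconv : ∀ n, Convex ℝ (T n).closedInterior := fun n => by
    rw [← Affine.Simplex.convexHull_eq_closedInterior]; exact convex_convexHull ℝ _
  have hdisj : Pairwise (Function.onFun (AEDisjoint volume)
      fun n => (T n).closedInterior ∩ Metric.ball Q r) := by
    intro m n hmn
    have hd : Disjoint (T m).interior (T n).interior := hT.nonoverlapping hmn
    rw [interior_eq, interior_eq] at hd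
    refine measure_mono_null (t := frontier (T m).closedInterior ∪ frontier (T n).closedInterior)
      ?_ (measure_union_null ((hconv m).addHaar_frontier _) ((hconv n).addHaar_frontier _))
    rintro P ⟨⟨hm, -⟩, hn, -⟩
    by_contra hP
    simp only [mem_union, not_or, frontier, Set.mem_sdiff, not_and, not_not] at hP
    exact disjoint_left.1 hd (hP.1 (subset_closure hm)) (hP.2 (subset_closure hn))
  have hmeas : ∀ n, NullMeasurableSet ((T n).closedInterior ∩ Metric.ball Q r) volume := fun n =>
    ((T n).isClosed_closedInterior.measurableSet.inter measurableSet_ball).nullMeasurableSet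
  have h3 := measure_iUnion₀ hdisj hmeas
  rw [← iUnion_inter, hT.union_eq, h2, tsum_fintype] at h3
  simp only [h1] at h3
  have hw := weight_nonneg
  rw [← ENNReal.ofReal_sum_of_nonneg (fun n _ => by have := hw (T n) Q; positivity),
    ENNReal.ofReal_eq_ofReal_iff (by have := hw ABC Q; positivity)
      (Finset.sum_nonneg fun n _ => by have := hw (T n) Q; positivity),
    ← Finset.sum_div, ← Finset.sum_mul] at h3
  have : (0 : ℝ) < r ^ 2 := by positivity
  field_simp at h3
  exact h3.symm

/-! ### Cells, and the edges leaving a point -/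

/-- The tiles, together with the tiled triangle, which stands for the region outside it. -/
def cell (ABC : Tri) (T : Fin N → Tri) (o : Option (Fin N)) : Tri := o.elim ABC T

@[simp] lemma cell_none : cell ABC T none = ABC := rfl

@[simp] lemma cell_some (n : Fin N) : cell ABC T (some n) = T n := rfl

/-- The angle that a tile, or the region outside `ABC`, fills around a point. -/
def fill (ABC : Tri) (T : Fin N → Tri) (Q : Plane) (o : Option (Fin N)) : ℝ :=
  o.elim (2 * Real.pi - weight ABC Q) (fun n => weight (T n) Q)

/-- The point `Q` is a vertex of a tile. -/
def IsVertex (T : Fin N → Tri) (Q : Plane) : Prop := ∃ n i, Q = (T n).points i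

lemma vertexAngle_pos (t : Tri) (i : Fin 3) : 0 < vertexAngle t i := by
  refine EuclideanGeometry.angle_pos_of_not_collinear ?_
  have h := (affineIndependent_iff_not_collinear_set (k := ℝ) (p₁ := t.points (i + 1))
    (p₂ := t.points i) (p₃ := t.points (i + 2))).1
  apply h
  have := t.independent.comp_embedding
    (⟨![i + 1, i, i + 2], by fin_cases i <;> decide⟩ : Fin 3 ↪ Fin 3)
  have e : ![t.points (i + 1), t.points i, t.points (i + 2)] =
      t.points ∘ (⟨![i + 1, i, i + 2], by fin_cases i <;> decide⟩ : Fin 3 ↪ Fin 3) := by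
    funext j
    fin_cases j <;> rfl
  rwa [e]

lemma vertexAngle_sum (t : Tri) :
    vertexAngle t 0 + vertexAngle t 1 + vertexAngle t 2 = Real.pi := by
  have h := EuclideanGeometry.angle_add_angle_add_angle_eq_pi (p₁ := t.points 0)
    (p₂ := t.points 1) (t.points 2) (points_ne t (by decide))
  unfold vertexAngle
  simp only [Fin.isValue, Fin.reduceAdd]
  linarith [angle_comm (t.points 0) (t.points 1) (t.points 2),
    angle_comm (t.points 1) (t.points 2) (t.points 0),
    angle_comm (t.points 2) (t.points 0) (t.points 1)]

lemma vertexAngle_lt_pi (t : Tri) (i : Fin 3) : vertexAngle t i < Real.pi := by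
  have h := vertexAngle_sum t
  have h0 := vertexAngle_pos t 0
  have h1 := vertexAngle_pos t 1
  have h2 := vertexAngle_pos t 2
  fin_cases i <;> simp <;> linarith

lemma weight_le (t : Tri) (Q : Plane) : weight t Q ≤ 2 * Real.pi := by
  have := Real.pi_pos
  by_cases hQ : Q ∈ t.closedInterior
  · rcases cases_of_mem_closedInterior hQ with h | ⟨k, h⟩ | ⟨i, rfl⟩
    · exact (weight_of_mem_interior h).le
    · rw [weight_of_onEdge h]; linarith
    · rw [weight_point]; linarith [vertexAngle_lt_pi t i]
  · rw [weight_of_notMem hQ]; positivity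

lemma fill_nonneg (Q : Plane) (o : Option (Fin N)) : 0 ≤ fill ABC T Q o := by
  rcases o with _ | n
  · simpa [fill] using weight_le ABC Q
  · exact weight_nonneg _ _

lemma fill_of_onEdge {Q : Plane} {o : Option (Fin N)} {k : Fin 3} (h : OnEdge (cell ABC T o) k Q) :
    fill ABC T Q o = Real.pi := by
  rcases o with _ | n
  · have := weight_of_onEdge h
    simp only [cell_none] at this
    simp only [fill, Option.elim, this]; ring
  · exact weight_of_onEdge h

lemma IsTiling.sum_fill (hT : IsTiling ABC R T) (Q : Plane) :
    ∑ o, fill ABC T Q o = 2 * Real.pi := by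
  rw [Fintype.sum_option]
  simp only [fill, Option.elim, hT.sum_weight]
  ring

/-- At most two cells meet in the relative interior of their edges. -/
lemma IsTiling.not_three (hT : IsTiling ABC R T) {Q : Plane} {o₁ o₂ o₃ : Option (Fin N)}
    {k₁ k₂ k₃ : Fin 3} (h₁₂ : o₁ ≠ o₂) (h₁₃ : o₁ ≠ o₃) (h₂₃ : o₂ ≠ o₃)
    (h₁ : OnEdge (cell ABC T o₁) k₁ Q) (h₂ : OnEdge (cell ABC T o₂) k₂ Q)
    (h₃ : OnEdge (cell ABC T o₃) k₃ Q) : False := by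
  have h := Finset.sum_le_univ_sum_of_nonneg (s := {o₁, o₂, o₃})
    (fill_nonneg (ABC := ABC) (T := T) Q)
  rw [hT.sum_fill, Finset.sum_insert (by simp [h₁₂, h₁₃]), Finset.sum_pair h₂₃,
    fill_of_onEdge h₁, fill_of_onEdge h₂, fill_of_onEdge h₃] at h
  linarith [Real.pi_pos]

lemma fill_pos_of_vertex {Q : Plane} {o : Option (Fin N)} {i : Fin 3}
    (h : Q = (cell ABC T o).points i) : 0 < fill ABC T Q o := by
  subst h
  rcases o with _ | n
  · simp only [fill, Option.elim, cell_none, weight_point]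
    linarith [vertexAngle_lt_pi ABC i, Real.pi_pos]
  · simp only [fill, Option.elim, cell_some, weight_point]
    exact vertexAngle_pos _ _

lemma IsTiling.fill_add_le (hT : IsTiling ABC R T) (Q : Plane) {o o' : Option (Fin N)}
    (h : o ≠ o') : fill ABC T Q o + fill ABC T Q o' ≤ 2 * Real.pi := by
  have h' := Finset.sum_le_univ_sum_of_nonneg (s := {o, o'})
    (fill_nonneg (ABC := ABC) (T := T) Q)
  rwa [hT.sum_fill, Finset.sum_pair h] at h'

/-- A point in the relative interior of edges of two cells is not a vertex. -/
lemma IsTiling.not_isVertex (hT : IsTiling ABC R T) {Q : Plane} {o₁ o₂ : Option (Fin N)}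
    {k₁ k₂ : Fin 3} (h₁₂ : o₁ ≠ o₂) (h₁ : OnEdge (cell ABC T o₁) k₁ Q)
    (h₂ : OnEdge (cell ABC T o₂) k₂ Q) : ¬ IsVertex T Q := by
  rintro ⟨n, i, hn⟩
  have hn' : Q = (cell ABC T (some n)).points i := hn
  have h1 : o₁ ≠ some n := by rintro rfl; exact h₁.ne_point i hn
  have h2 : o₂ ≠ some n := by rintro rfl; exact h₂.ne_point i hn
  have h := Finset.sum_le_univ_sum_of_nonneg (s := {o₁, o₂, some n})
    (fill_nonneg (ABC := ABC) (T := T) Q)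
  rw [hT.sum_fill, Finset.sum_insert (by simp [h₁₂, h1]), Finset.sum_pair h2,
    fill_of_onEdge h₁, fill_of_onEdge h₂] at h
  linarith [Real.pi_pos, fill_pos_of_vertex hn']

lemma IsTiling.not_corner_of_onEdge (hT : IsTiling ABC R T) {Q : Plane} {n : Fin N} {k i : Fin 3}
    (h : OnEdge (T n) k Q) : Q ≠ ABC.points i := by
  rintro rfl
  have h1 := hT.fill_add_le (ABC.points i) (o := none) (o' := some n) (by simp)
  have h2 : fill ABC T (ABC.points i) (some n) = Real.pi := weight_of_onEdge h
  rw [h2] at h1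
  simp only [fill, Option.elim, weight_point] at h1
  linarith [vertexAngle_lt_pi ABC i]

lemma IsTiling.isVertex_corner (hT : IsTiling ABC R T) (i : Fin 3) :
    IsVertex T (ABC.points i) := by
  have h := ABC.point_mem_closedInterior i
  rw [← hT.union_eq] at h
  obtain ⟨n, hn⟩ := mem_iUnion.1 h
  rcases cases_of_mem_closedInterior hn with h | ⟨k, h⟩ | ⟨j, h⟩
  · have h1 := hT.fill_add_le (ABC.points i) (o := none) (o' := some n) (by simp)
    have h2 : fill ABC T (ABC.points i) (some n) = 2 * Real.pi := weight_of_mem_interior h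
    rw [h2] at h1
    simp only [fill, Option.elim, weight_point] at h1
    linarith [vertexAngle_lt_pi ABC i, Real.pi_pos]
  · exact absurd rfl (hT.not_corner_of_onEdge h)
  · exact ⟨n, j, h⟩

lemma IsTiling.ne_point_of_not_isVertex (hT : IsTiling ABC R T) {Q : Plane} (h : ¬ IsVertex T Q)
    (o : Option (Fin N)) (i : Fin 3) : Q ≠ (cell ABC T o).points i := by
  rintro rfl
  rcases o with _ | n
  · exact h (hT.isVertex_corner i)
  · exact h ⟨n, i, rfl⟩

lemma fill_eq_of_not_isVertex {Q : Plane} {o : Option (Fin N)}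
    (h : ∀ i, Q ≠ (cell ABC T o).points i) :
    (∃ k, OnEdge (cell ABC T o) k Q) ∨ fill ABC T Q o = 0 ∨ fill ABC T Q o = 2 * Real.pi := by
  have key : (∃ k, OnEdge (cell ABC T o) k Q) ∨ weight (cell ABC T o) Q = 0 ∨
      weight (cell ABC T o) Q = 2 * Real.pi := by
    by_cases hQ : Q ∈ (cell ABC T o).closedInterior
    · rcases cases_of_mem_closedInterior hQ with h' | h' | ⟨i, h'⟩
      · exact Or.inr (Or.inr (weight_of_mem_interior h'))
      · exact Or.inl h'
      · exact absurd h' (h i)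
    · exact Or.inr (Or.inl (weight_of_notMem hQ))
  rcases o with _ | n
  · rcases key with h | h | h
    · exact Or.inl h
    · right; right; simp only [cell_none] at h; simp [fill, h]
    · right; left; simp only [cell_none] at h; simp [fill, h]
  · exact key

/-- On both sides of an edge there is a cell. -/
lemma IsTiling.exists_opposite (hT : IsTiling ABC R T) {Q : Plane} (hQ : ¬ IsVertex T Q)
    {o : Option (Fin N)} {k : Fin 3} (h : OnEdge (cell ABC T o) k Q) :
    ∃ o' k', o' ≠ o ∧ OnEdge (cell ABC T o') k' Q := by
  by_contra! hno
  have hzero : ∀ o' ≠ o, fill ABC T Q o' = 0 := by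
    intro o' ho'
    rcases fill_eq_of_not_isVertex (hT.ne_point_of_not_isVertex hQ o') with ⟨k', h'⟩ | h' | h'
    · exact absurd h' (hno o' k' ho')
    · exact h'
    · have h1 := hT.fill_add_le Q ho'
      rw [h', fill_of_onEdge h] at h1
      linarith [Real.pi_pos]
  have hsum := hT.sum_fill Q
  rw [Finset.sum_eq_single o (fun o' _ ho' => hzero o' ho') (by simp), fill_of_onEdge h] at hsum
  linarith [Real.pi_pos]

/-- Immediately after leaving `P` in the direction `v`, one moves along the edge of `t` opposite
the vertex `k`. -/
def Germ (t : Tri) (k : Fin 3) (P v : Plane) : Prop :=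
  ∀ᶠ ε in 𝓝[>] (0 : ℝ), OnEdge t k (P + ε • v)

/-- An affine function on the line has a constant sign immediately to the right of `0`. -/
lemma eventually_sign (a b : ℝ) :
    (∀ᶠ ε in 𝓝[>] (0 : ℝ), 0 < a + ε * b) ∨ (∀ᶠ ε in 𝓝[>] (0 : ℝ), a + ε * b < 0) ∨
      (a = 0 ∧ b = 0) := by
  have hc : ContinuousAt (fun ε : ℝ => a + ε * b) 0 := by fun_prop
  have h0 : (fun ε : ℝ => a + ε * b) 0 = a := by simp
  rcases lt_trichotomy a 0 with h | h | h
  · right; left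
    exact (hc.eventually (gt_mem_nhds (by rwa [h0]))).filter_mono nhdsWithin_le_nhds
  · rcases lt_trichotomy b 0 with h' | h' | h'
    · right; left
      filter_upwards [self_mem_nhdsWithin] with ε hε
      rw [h, zero_add]; exact mul_neg_of_pos_of_neg hε h'
    · exact Or.inr (Or.inr ⟨h, h'⟩)
    · left
      filter_upwards [self_mem_nhdsWithin] with ε hε
      rw [h, zero_add]; exact mul_pos hε h'
  · left
    exact (hc.eventually (lt_mem_nhds (by rwa [h0]))).filter_mono nhdsWithin_le_nhds

lemma germ_or_not (t : Tri) (k : Fin 3) (P v : Plane) :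
    Germ t k P v ∨ ∀ᶠ ε in 𝓝[>] (0 : ℝ), ¬ OnEdge t k (P + ε • v) := by
  simp only [Germ, OnEdge, coord_add_smul]
  rcases eventually_sign (coord t k P) ((coord t k).linear v) with h | h | ⟨h0, h0'⟩
  · right; filter_upwards [h] with ε h1 h2 using h1.ne' h2.1
  · right; filter_upwards [h] with ε h1 h2 using h1.ne h2.1
  rcases eventually_sign (coord t (k + 1) P) ((coord t (k + 1)).linear v) with h1 | h1 | ⟨h1, h1'⟩
  · rcases eventually_sign (coord t (k + 2) P) ((coord t (k + 2)).linear v) with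
      h2 | h2 | ⟨h2, h2'⟩
    · left; filter_upwards [h1, h2] with ε h1 h2 using ⟨by simp [h0, h0'], h1, h2⟩
    · right; filter_upwards [h2] with ε h1 h2 using h1.not_gt h2.2.2
    · right; simp [h2, h2']
  · right; filter_upwards [h1] with ε h1 h2 using h1.not_gt h2.2.1
  · right; simp [h1, h1']

/-- A half-edge is an edge of a tile with a direction. The edge is given by its opposite vertex `k`,
called its type; the direction is from the vertex `k + 1` to the vertex `k + 2` if the
Boolean is `true`, and the reverse otherwise. -/
abbrev HalfEdge (N : ℕ) : Type := Fin N × Fin 3 × Bool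

/-- The vertex at which a directed edge begins. -/
def startIdx (k : Fin 3) (s : Bool) : Fin 3 := if s then k + 1 else k + 2

/-- The directed edge, as a vector. -/
def edgeVec (t : Tri) (k : Fin 3) (s : Bool) : Plane :=
  t.points (startIdx k (!s)) - t.points (startIdx k s)

lemma startIdx_ne (k : Fin 3) (s : Bool) : startIdx k s ≠ k := by
  cases s <;> simp [startIdx]

lemma startIdx_not_ne (k : Fin 3) (s : Bool) : startIdx k (!s) ≠ startIdx k s := by
  cases s <;> simp [startIdx]

lemma edgeVec_not (t : Tri) (k : Fin 3) (s : Bool) : edgeVec t k (!s) = -edgeVec t k s := by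
  simp [edgeVec]

lemma edgeVec_ne_zero (t : Tri) (k : Fin 3) (s : Bool) : edgeVec t k s ≠ 0 :=
  sub_ne_zero.2 (points_ne t (startIdx_not_ne k s))

lemma norm_edgeVec (t : Tri) (k : Fin 3) (s : Bool) : ‖edgeVec t k s‖ = side t k := by
  cases s <;> simp [edgeVec, startIdx, side, dist_eq_norm]
  rw [norm_sub_rev]

/-- A version of `OnEdge` adapted to directed edges. -/
lemma onEdge_iff (t : Tri) (k : Fin 3) (s : Bool) (Q : Plane) :
    OnEdge t k Q ↔ coord t k Q = 0 ∧ 0 < coord t (startIdx k s) Q ∧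
      0 < coord t (startIdx k (!s)) Q := by
  cases s <;> simp [OnEdge, startIdx]
  tauto

lemma linear_edgeVec (t : Tri) (k : Fin 3) (s : Bool) :
    (coord t k).linear (edgeVec t k s) = 0 ∧
    (coord t (startIdx k s)).linear (edgeVec t k s) = -1 ∧
    (coord t (startIdx k (!s))).linear (edgeVec t k s) = 1 := by
  have h := startIdx_not_ne k s
  simp only [edgeVec, coord_linear_sub]
  rw [coord_self, coord_self, coord_of_ne t h, coord_of_ne t h.symm,
    coord_of_ne t (startIdx_ne k s).symm, coord_of_ne t (startIdx_ne k (!s)).symm]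
  norm_num

/-- A vector along an edge is a multiple of the directed edge. -/
lemma eq_smul_edgeVec (t : Tri) (k : Fin 3) (s : Bool) {v : Plane}
    (h : (coord t k).linear v = 0) :
    v = (coord t (startIdx k (!s))).linear v • edgeVec t k s := by
  obtain ⟨h0, h1, h2⟩ := linear_edgeVec t k s
  have key : ∀ w, (coord t k).linear w = 0 → (coord t (startIdx k (!s))).linear w = 0 → w = 0 := by
    intro w hw hw'
    have h3 : t.points k + w = t.points k := by
      apply ext_coord t
      have e : ∀ j, coord t j (t.points k + w) = coord t j (t.points k) + (coord t j).linear w :=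
        fun j => by have := coord_add_smul t j (t.points k) w 1; simpa using this
      have s1 := coord_add t k (t.points k + w)
      have s2 := coord_add t k (t.points k)
      rw [forall_fin_three k]
      rw [e, e, e, hw] at s1
      rw [e, e, e, hw]
      cases s
      · simp only [startIdx, Bool.not_false, if_true] at hw'
        rw [hw'] at s1 ⊢
        refine ⟨by ring, by ring, by linarith⟩
      · simp [startIdx] at hw'
        rw [hw'] at s1 ⊢
        refine ⟨by ring, by linarith, by ring⟩
    simpa using h3
  rw [← sub_eq_zero]
  apply key <;> simp [h, h0, h2]

lemma onEdge_add_smul_edgeVec (t : Tri) (k : Fin 3) (s : Bool) {ε : ℝ} (h0 : 0 < ε) (h1 : ε < 1) :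
    OnEdge t k (t.points (startIdx k s) + ε • edgeVec t k s) := by
  obtain ⟨e0, e1, e2⟩ := linear_edgeVec t k s
  rw [onEdge_iff t k s]
  simp only [coord_add_smul, e0, e1, e2, coord_self]
  rw [coord_of_ne t (startIdx_ne k s).symm, coord_of_ne t (startIdx_not_ne k s)]
  refine ⟨by ring, by linarith, by linarith⟩

lemma germ_edgeVec (t : Tri) (k : Fin 3) (s : Bool) {c : ℝ} (hc : 0 < c) :
    Germ t k (t.points (startIdx k s)) (c • edgeVec t k s) := by
  filter_upwards [Ioo_mem_nhdsGT (inv_pos.2 hc)] with ε ⟨h0, h1⟩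
  rw [smul_smul]
  refine onEdge_add_smul_edgeVec t k s (by positivity) ?_
  calc ε * c < c⁻¹ * c := by gcongr
    _ = 1 := inv_mul_cancel₀ hc.ne'

lemma germ_of_onEdge {t : Tri} {k : Fin 3} {P v : Plane} (h : OnEdge t k P)
    (hv : (coord t k).linear v = 0) : Germ t k P v := by
  have hc : ∀ j, ContinuousAt (fun ε : ℝ => coord t j P + ε * (coord t j).linear v) 0 :=
    fun j => by fun_prop
  have hpos : ∀ j, 0 < coord t j P → ∀ᶠ ε in 𝓝[>] (0 : ℝ), 0 < coord t j (P + ε • v) := by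
    intro j hj
    simp only [coord_add_smul]
    exact ((hc j).eventually (lt_mem_nhds (by simpa using hj))).filter_mono nhdsWithin_le_nhds
  filter_upwards [hpos _ h.2.1, hpos _ h.2.2] with ε h1 h2
  exact ⟨by rw [coord_add_smul, h.1, hv]; ring, h1, h2⟩

lemma Germ.linear_eq_zero {t : Tri} {k : Fin 3} {P v : Plane} (h : Germ t k P v) :
    coord t k P = 0 ∧ (coord t k).linear v = 0 := by
  rcases eventually_sign (coord t k P) ((coord t k).linear v) with h' | h' | h'
  · obtain ⟨ε, h1, h2⟩ := (h'.and h).exists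
    rw [← coord_add_smul, h2.1] at h1; exact absurd h1 (lt_irrefl _)
  · obtain ⟨ε, h1, h2⟩ := (h'.and h).exists
    rw [← coord_add_smul, h2.1] at h1; exact absurd h1 (lt_irrefl _)
  · exact h'

/-- An edge that leaves `P` in the direction `v` either passes through `P` or begins there. -/
lemma Germ.cases {t : Tri} {k : Fin 3} {P v : Plane} (h : Germ t k P v) :
    OnEdge t k P ∨ ∃ s, P = t.points (startIdx k s) ∧ ∃ c : ℝ, 0 < c ∧ v = c • edgeVec t k s := by
  obtain ⟨h0, hv⟩ := h.linear_eq_zero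
  have hge : ∀ j, (∀ᶠ ε in 𝓝[>] (0 : ℝ), 0 < coord t j (P + ε • v)) →
      0 < coord t j P ∨ (coord t j P = 0 ∧ 0 < (coord t j).linear v) := by
    intro j hj
    simp only [coord_add_smul] at hj
    by_contra hcon
    push Not at hcon
    rcases hcon.1.lt_or_eq with h1 | h1
    · have hc : ContinuousAt (fun ε : ℝ => coord t j P + ε * (coord t j).linear v) 0 := by
        fun_prop
      have := (hc.eventually (gt_mem_nhds (a := 0) (by simpa using h1))).filter_mono
        (nhdsWithin_le_nhds (s := Ioi 0))
      obtain ⟨ε, h2, h3⟩ := (hj.and this).exists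
      linarith
    · have h2 := hcon.2 h1
      obtain ⟨ε, h3, h4⟩ := (hj.and self_mem_nhdsWithin).exists
      rw [h1, zero_add] at h3
      exact absurd h3 (not_lt.2 (mul_nonpos_of_nonneg_of_nonpos (le_of_lt h4) h2))
  have hstart : ∀ s, coord t (startIdx k (!s)) P = 0 → 0 < (coord t (startIdx k (!s))).linear v →
      P = t.points (startIdx k s) ∧ ∃ c : ℝ, 0 < c ∧ v = c • edgeVec t k s := by
    intro s hs hs'
    refine ⟨?_, (coord t (startIdx k (!s))).linear v, hs', eq_smul_edgeVec t k s hv⟩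
    cases s
    · apply eq_point_of_coord_eq_zero
      · simp only [startIdx, Bool.false_eq_true, if_false]
        rw [show k + 2 + 1 = k by fin_cases k <;> rfl, h0]
      · simp only [startIdx, Bool.false_eq_true, if_false, Bool.not_false, if_true] at hs ⊢
        rw [show k + 2 + 2 = k + 1 by fin_cases k <;> rfl, hs]
    · apply eq_point_of_coord_eq_zero
      · simp only [startIdx, Bool.not_true, if_true, Bool.false_eq_true, if_false] at hs ⊢
        rw [show k + 1 + 1 = k + 2 by fin_cases k <;> rfl, hs]
      · simp only [startIdx, if_true]
        rw [show k + 1 + 2 = k by fin_cases k <;> rfl, h0]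
  have h1 := hge (k + 1) (Eventually.mono h fun ε h => h.2.1)
  have h2 := hge (k + 2) (Eventually.mono h fun ε h => h.2.2)
  rcases h1 with h1 | h1
  · rcases h2 with h2 | h2
    · exact Or.inl ⟨h0, h1, h2⟩
    · exact Or.inr ⟨true, hstart true h2.1 h2.2⟩
  · exact Or.inr ⟨false, hstart false h1.1 h1.2⟩

lemma Germ.unique {t : Tri} {k k' : Fin 3} {P v : Plane} (h : Germ t k P v) (h' : Germ t k' P v) :
    k = k' := by
  obtain ⟨ε, h1, h2⟩ := (Eventually.and h h').exists
  exact h1.unique h2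

lemma eventually_not_isVertex (T : Fin N → Tri) (P : Plane) {v : Plane} (hv : v ≠ 0) :
    ∀ᶠ ε in 𝓝[>] (0 : ℝ), ¬ IsVertex T (P + ε • v) := by
  simp only [IsVertex, not_exists]
  rw [eventually_all]; intro n
  rw [eventually_all]; intro i
  by_cases h : (T n).points i = P
  · filter_upwards [self_mem_nhdsWithin] with ε hε
    rw [h]
    simpa [hv] using (ne_of_gt hε)
  · have hc : ContinuousAt (fun ε : ℝ => P + ε • v) 0 := by fun_prop
    refine (hc.eventually (isOpen_ne.mem_nhds ?_)).filter_mono nhdsWithin_le_nhds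
    simpa using Ne.symm h

/-- An edge of a cell that leaves `P` in the direction `v` has another cell on its other side. -/
lemma IsTiling.exists_germ (hT : IsTiling ABC R T) {P v : Plane} (hv : v ≠ 0)
    {o : Option (Fin N)} {k : Fin 3} (h : Germ (cell ABC T o) k P v) :
    ∃ o' k', o' ≠ o ∧ Germ (cell ABC T o') k' P v := by
  by_contra! hno
  have h1 : ∀ᶠ ε in 𝓝[>] (0 : ℝ), ∀ o' k', o' ≠ o → ¬ OnEdge (cell ABC T o') k' (P + ε • v) := by
    rw [eventually_all]; intro o'
    rw [eventually_all]; intro k'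
    by_cases ho : o' = o
    · exact Eventually.of_forall fun ε h => absurd ho h
    · filter_upwards [(germ_or_not _ k' P v).resolve_left (hno o' k' ho)] with ε h _ using h
  obtain ⟨ε, h2, h3, h4⟩ := (h1.and ((eventually_not_isVertex T P hv).and h)).exists
  obtain ⟨o', k', h5, h6⟩ := hT.exists_opposite h3 h4
  exact h2 o' k' h5 h6

lemma IsTiling.not_three_germs (hT : IsTiling ABC R T) {P v : Plane} {o₁ o₂ o₃ : Option (Fin N)}
    {k₁ k₂ k₃ : Fin 3} (h₁₂ : o₁ ≠ o₂) (h₁₃ : o₁ ≠ o₃) (h₂₃ : o₂ ≠ o₃)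
    (h₁ : Germ (cell ABC T o₁) k₁ P v) (h₂ : Germ (cell ABC T o₂) k₂ P v)
    (h₃ : Germ (cell ABC T o₃) k₃ P v) : False := by
  obtain ⟨ε, h1, h2, h3⟩ := (Eventually.and h₁ (Eventually.and h₂ h₃)).exists
  exact hT.not_three h₁₂ h₁₃ h₂₃ h1 h2 h3

/-! ### Vertices, half-edges and their partners -/

lemma IsTiling.vertexAngle_eq (hT : IsTiling ABC R T) (n : Fin N) (i : Fin 3) :
    vertexAngle (T n) i = vertexAngle R i :=
  angle_eq_of_congruent (hT.congruent n) _ _ _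

lemma IsTiling.side_eq (hT : IsTiling ABC R T) (n : Fin N) (k : Fin 3) :
    side (T n) k = side R k := (hT.congruent n).dist_eq _ _

open Classical in
/-- The number of tiles having their vertex labelled `i` at the point `P`. -/
def cnt (T : Fin N → Tri) (i : Fin 3) (P : Plane) : ℕ :=
  (Finset.univ.filter fun n => P = (T n).points i).card

lemma IsTiling.sum_vertex_angles (hT : IsTiling ABC R T) (P : Plane) :
    open Classical in
    (∑ n, ∑ i, if P = (T n).points i then vertexAngle (T n) i else 0) =
      ∑ i, (cnt T i P : ℝ) * vertexAngle R i := by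
  classical
  rw [Finset.sum_comm]
  refine Finset.sum_congr rfl fun i _ => ?_
  simp only [hT.vertexAngle_eq]
  rw [← Finset.sum_filter, Finset.sum_const, nsmul_eq_mul, cnt]

lemma weight_eq_vertex_part {t : Tri} {P : Plane} (h : P ∉ t.interior) (h' : ∀ k, ¬ OnEdge t k P) :
    open Classical in
    weight t P = ∑ i, if P = t.points i then vertexAngle t i else 0 := by
  simp [weight, h, h']

lemma IsVertex.not_mem_interior (hT : IsTiling ABC R T) {P : Plane} (h : IsVertex T P)
    (n : Fin N) : P ∉ (T n).interior := by
  obtain ⟨m, i, hm⟩ := h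
  intro hn
  have hmn : (some m : Option (Fin N)) ≠ some n := by
    rintro h
    rw [Option.some_inj] at h
    subst h
    rw [hm] at hn
    exact not_mem_interior_point _ _ hn
  have h1 := hT.fill_add_le P hmn
  have h2 : fill ABC T P (some n) = 2 * Real.pi := weight_of_mem_interior hn
  have h3 : 0 < fill ABC T P (some m) := fill_pos_of_vertex (i := i) hm
  linarith

/-- The tiles at a corner of `ABC` fill up its angle. -/
lemma IsTiling.angle_sum_corner (hT : IsTiling ABC R T) (j : Fin 3) :
    ∑ i, (cnt T i (ABC.points j) : ℝ) * vertexAngle R i = vertexAngle ABC j := by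
  rw [← hT.sum_vertex_angles, ← weight_point ABC j, ← hT.sum_weight]
  refine Finset.sum_congr rfl fun n _ => ?_
  rw [weight_eq_vertex_part ((hT.isVertex_corner j).not_mem_interior hT n)]
  exact fun k hk => hT.not_corner_of_onEdge hk rfl

/-- The tiles having a vertex at a relative interior point of an edge fill up a straight angle. -/
lemma IsTiling.angle_sum_flat (hT : IsTiling ABC R T) {P : Plane} (hP : IsVertex T P)
    {o : Option (Fin N)} {k : Fin 3} (h : OnEdge (cell ABC T o) k P) :
    ∑ i, (cnt T i P : ℝ) * vertexAngle R i = Real.pi := by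
  classical
  have hother : ∀ o' ≠ o, ∀ k', ¬ OnEdge (cell ABC T o') k' P :=
    fun o' ho' k' hk' => hT.not_isVertex ho' hk' h hP
  have hw : ∀ n, some n ≠ o → weight (T n) P =
      ∑ i, if P = (T n).points i then vertexAngle (T n) i else 0 := fun n hn =>
    weight_eq_vertex_part (hP.not_mem_interior hT n) (hother (some n) hn)
  have hsum := hT.sum_weight P
  rw [← hT.sum_vertex_angles]
  rcases o with _ | m
  · rw [← weight_of_onEdge h, cell_none, ← hsum]
    exact Finset.sum_congr rfl fun n _ => (hw n (by simp)).symm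
  · rw [cell_some] at h
    have hABC : weight ABC P = 2 * Real.pi := by
      have hmem : P ∈ ABC.closedInterior := hT.subset m h.mem_closedInterior
      rcases cases_of_mem_closedInterior hmem with h' | ⟨k', h'⟩ | ⟨i, h'⟩
      · exact weight_of_mem_interior h'
      · exact absurd h' (hother none (by simp) k')
      · exact absurd h' (hT.not_corner_of_onEdge h)
    have hm : weight (T m) P = Real.pi := weight_of_onEdge h
    have hm' : (∑ i, if P = (T m).points i then vertexAngle (T m) i else 0) = 0 :=
      Finset.sum_eq_zero fun i _ => if_neg (h.ne_point i)
    rw [hABC, ← Finset.add_sum_erase _ _ (Finset.mem_univ m), hm] at hsum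
    rw [← Finset.add_sum_erase _ _ (Finset.mem_univ m), hm', zero_add]
    rw [Finset.sum_congr rfl fun n hn => (hw n (by simpa using Finset.ne_of_mem_erase hn)).symm]
    linarith

/-- The tiles at a vertex in the interior of `ABC` that is on no edge fill up a full angle. -/
lemma IsTiling.angle_sum_inner (hT : IsTiling ABC R T) {P : Plane} (hP : IsVertex T P)
    (h : ∀ o k, ¬ OnEdge (cell ABC T o) k P) (h' : ∀ j, P ≠ ABC.points j) :
    ∑ i, (cnt T i P : ℝ) * vertexAngle R i = 2 * Real.pi := by
  have hmem : P ∈ ABC.closedInterior := by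
    obtain ⟨n, i, rfl⟩ := hP
    exact hT.subset n ((T n).point_mem_closedInterior i)
  rcases cases_of_mem_closedInterior hmem with hi | ⟨k', hk⟩ | ⟨i, hi⟩
  · rw [← hT.sum_vertex_angles, ← weight_of_mem_interior hi, ← hT.sum_weight]
    refine Finset.sum_congr rfl fun n _ => ?_
    rw [weight_eq_vertex_part (hP.not_mem_interior hT n) (h (some n))]
  · exact absurd hk (h none k')
  · exact absurd hi (h' i)

/-- The point at which a half-edge begins. -/
def org (T : Fin N → Tri) (h : HalfEdge N) : Plane := (T h.1).points (startIdx h.2.1 h.2.2)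

/-- The vector from the beginning to the end of a half-edge. -/
def vec (T : Fin N → Tri) (h : HalfEdge N) : Plane := edgeVec (T h.1) h.2.1 h.2.2

lemma vec_ne_zero (T : Fin N → Tri) (h : HalfEdge N) : vec T h ≠ 0 := edgeVec_ne_zero _ _ _

lemma isVertex_org (T : Fin N → Tri) (h : HalfEdge N) : IsVertex T (org T h) := ⟨_, _, rfl⟩

/-- Two vectors point in the same direction. -/
def SameDir (v w : Plane) : Prop := ∃ c : ℝ, 0 < c ∧ w = c • v

lemma SameDir.refl (v : Plane) : SameDir v v := ⟨1, one_pos, by simp⟩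

lemma SameDir.symm {v w : Plane} (h : SameDir v w) : SameDir w v := by
  obtain ⟨c, hc, rfl⟩ := h
  exact ⟨c⁻¹, by positivity, by rw [smul_smul, inv_mul_cancel₀ hc.ne', one_smul]⟩

lemma SameDir.trans {u v w : Plane} (h : SameDir u v) (h' : SameDir v w) : SameDir u w := by
  obtain ⟨c, hc, rfl⟩ := h
  obtain ⟨d, hd, rfl⟩ := h'
  exact ⟨d * c, by positivity, by rw [smul_smul]⟩

lemma germ_of_sameDir (ABC : Tri) {T : Fin N → Tri} {h : HalfEdge N} {P v : Plane}
    (hP : org T h = P) (hv : SameDir (vec T h) v) : Germ (cell ABC T (some h.1)) h.2.1 P v := by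
  obtain ⟨c, hc, rfl⟩ := hv
  subst hP
  exact germ_edgeVec _ _ _ hc

/-- The half-edges `h` and `h'`, of different tiles, begin at the same point in the same
direction, so that their tiles meet along a segment there. -/
def Partner (T : Fin N → Tri) (h h' : HalfEdge N) : Prop :=
  h.1 ≠ h'.1 ∧ org T h = org T h' ∧ SameDir (vec T h) (vec T h')

lemma Partner.symm {h h' : HalfEdge N} (hp : Partner T h h') : Partner T h' h :=
  ⟨hp.1.symm, hp.2.1.symm, hp.2.2.symm⟩

lemma eq_of_sameDir {h h' : HalfEdge N} (h1 : h.1 = h'.1) (h2 : org T h = org T h')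
    (h3 : SameDir (vec T h) (vec T h')) : h = h' := by
  obtain ⟨n, k, s⟩ := h
  obtain ⟨n', k', s'⟩ := h'
  obtain rfl : n = n' := h1
  have g := germ_of_sameDir (T n) (T := T) (h := (n, k, s)) rfl h3
  have g' := germ_of_sameDir (T n) (T := T) h2.symm (.refl _)
  obtain rfl : k = k' := g.unique g'
  have h4 : startIdx k s = startIdx k s' := (T n).independent.injective h2
  have h5 : s = s' := by
    by_contra hne
    rw [show s' = !s by cases s <;> cases s' <;> simp_all] at h4
    exact startIdx_not_ne k s h4.symm
  rw [h5]

lemma IsTiling.partner_unique (hT : IsTiling ABC R T) {h h₁ h₂ : HalfEdge N}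
    (hp₁ : Partner T h h₁) (hp₂ : Partner T h h₂) : h₁ = h₂ := by
  have hd : SameDir (vec T h₁) (vec T h₂) := hp₁.2.2.symm.trans hp₂.2.2
  have ho : org T h₁ = org T h₂ := hp₁.2.1.symm.trans hp₂.2.1
  by_cases h12 : h₁.1 = h₂.1
  · exact eq_of_sameDir h12 ho hd
  · exfalso
    refine hT.not_three_germs (o₁ := some h.1) (o₂ := some h₁.1) (o₃ := some h₂.1) (P := org T h)
      (v := vec T h) ?_ ?_ ?_ (germ_of_sameDir ABC rfl (.refl _))
      (germ_of_sameDir ABC hp₁.2.1.symm hp₁.2.2.symm)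
      (germ_of_sameDir ABC hp₂.2.1.symm hp₂.2.2.symm)
    · simpa using hp₁.1
    · simpa using hp₂.1
    · simpa using h12

/-- If an edge of the cell `o` leaves `P` in the direction `v`, then at most one half-edge that does
not belong to `o` begins at `P` in this direction. -/
lemma IsTiling.eq_of_germ (hT : IsTiling ABC R T) {P v : Plane} {h h' : HalfEdge N}
    {o : Option (Fin N)} {k : Fin 3} (hg : Germ (cell ABC T o) k P v)
    (hP : org T h = P) (hP' : org T h' = P) (hv : SameDir (vec T h) v)
    (hv' : SameDir (vec T h') v) (ho : some h.1 ≠ o) (ho' : some h'.1 ≠ o) : h = h' := by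
  by_cases h12 : h.1 = h'.1
  · exact eq_of_sameDir h12 (hP.trans hP'.symm) (hv.trans hv'.symm)
  · exact (hT.not_three_germs (by simpa using h12) ho ho' (germ_of_sameDir ABC hP hv)
      (germ_of_sameDir ABC hP' hv') hg).elim

/-- If an edge of a cell leaves `P` in the direction `v`, then on its other side a half-edge begins
at `P` in this direction, unless the edge on the other side passes through `P`, or is a side of
`ABC` beginning at `P`. -/
lemma IsTiling.exists_halfEdge (hT : IsTiling ABC R T) {P v : Plane} (hv : v ≠ 0)
    {o : Option (Fin N)} {k : Fin 3} (hg : Germ (cell ABC T o) k P v) :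
    (∃ h : HalfEdge N, some h.1 ≠ o ∧ org T h = P ∧ SameDir (vec T h) v) ∨
      (∃ o' k', o' ≠ o ∧ OnEdge (cell ABC T o') k' P ∧ (coord (cell ABC T o') k').linear v = 0) ∨
      (o ≠ none ∧ ∃ k s, P = ABC.points (startIdx k s) ∧ SameDir (edgeVec ABC k s) v) := by
  obtain ⟨o', k', ho', hg'⟩ := hT.exists_germ hv hg
  rcases hg'.cases with h | ⟨s, h1, h2⟩
  · exact Or.inr (Or.inl ⟨o', k', ho', h, hg'.linear_eq_zero.2⟩)
  · rcases o' with _ | n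
    · exact Or.inr (Or.inr ⟨ho'.symm, k', s, h1, h2⟩)
    · exact Or.inl ⟨(n, k', s), ho', h1.symm, h2⟩

/-- At a relative interior point of an edge, a vertex of the tiling is the beginning of a half-edge
in each of the two directions of the edge. -/
lemma IsTiling.exists_halfEdge_flat (hT : IsTiling ABC R T) {P : Plane} (hP : IsVertex T P)
    {o : Option (Fin N)} {k : Fin 3} (h : OnEdge (cell ABC T o) k P) {v : Plane} (hv : v ≠ 0)
    (hl : (coord (cell ABC T o) k).linear v = 0) :
    ∃ h : HalfEdge N, some h.1 ≠ o ∧ org T h = P ∧ SameDir (vec T h) v := by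
  rcases hT.exists_halfEdge hv (germ_of_onEdge h hl) with h1 | ⟨o', k', ho', h1, -⟩ |
    ⟨ho, k', s, h1, -⟩
  · exact h1
  · exact absurd hP (hT.not_isVertex ho' h1 h)
  · rcases o with _ | n
    · exact absurd rfl ho
    · exact absurd h1 (hT.not_corner_of_onEdge h)

lemma IsTiling.exists_halfEdge_corner (hT : IsTiling ABC R T) (k : Fin 3) (s : Bool) :
    ∃ h : HalfEdge N, org T h = ABC.points (startIdx k s) ∧
      SameDir (vec T h) (edgeVec ABC k s) := by
  have hg : Germ (cell ABC T none) k (ABC.points (startIdx k s)) (edgeVec ABC k s) := by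
    simpa using germ_edgeVec ABC k s one_pos
  rcases hT.exists_halfEdge (edgeVec_ne_zero ABC k s) hg with ⟨h, -, h1⟩ | ⟨o', k', ho', h1, -⟩ |
    ⟨ho, -⟩
  · exact ⟨h, h1⟩
  · rcases o' with _ | n
    · exact absurd rfl ho'
    · exact absurd rfl (hT.not_corner_of_onEdge h1)
  · exact absurd rfl ho

/-- A half-edge has a partner unless it is along an edge passing through its beginning, or along a
side of `ABC` beginning there. -/
lemma IsTiling.exists_partner (hT : IsTiling ABC R T) (h : HalfEdge N) :
    (∃ h', Partner T h h') ∨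
      (∃ o k, OnEdge (cell ABC T o) k (org T h) ∧ (coord (cell ABC T o) k).linear (vec T h) = 0) ∨
      (∃ k s, org T h = ABC.points (startIdx k s) ∧ SameDir (edgeVec ABC k s) (vec T h)) := by
  rcases hT.exists_halfEdge (vec_ne_zero T h) (germ_of_sameDir ABC rfl (.refl _)) with
    ⟨h', h1, h2, h3⟩ | ⟨o', k', -, h1⟩ | ⟨-, h1⟩
  · exact Or.inl ⟨h', fun e => h1 (by rw [e]), h2.symm, h3.symm⟩
  · exact Or.inr (Or.inl ⟨o', k', h1⟩)
  · exact Or.inr (Or.inr h1)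

lemma IsTiling.not_partner_flat (hT : IsTiling ABC R T) {h h' : HalfEdge N}
    {o : Option (Fin N)} {k : Fin 3} (ho : OnEdge (cell ABC T o) k (org T h))
    (hl : (coord (cell ABC T o) k).linear (vec T h) = 0) : ¬ Partner T h h' := by
  intro hp
  have hne : ∀ g : HalfEdge N, org T g = org T h → some g.1 ≠ o := by
    rintro g hg rfl
    exact ho.ne_point _ hg.symm
  exact hT.not_three_germs (by simpa using hp.1) (hne h rfl) (hne h' hp.2.1.symm)
    (germ_of_sameDir ABC rfl (.refl _)) (germ_of_sameDir ABC hp.2.1.symm hp.2.2.symm)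
    (germ_of_onEdge ho hl)

lemma IsTiling.not_partner_corner (hT : IsTiling ABC R T) {h h' : HalfEdge N} {k : Fin 3} {s : Bool}
    (ho : org T h = ABC.points (startIdx k s)) (hl : SameDir (edgeVec ABC k s) (vec T h)) :
    ¬ Partner T h h' := by
  intro hp
  have hg : Germ (cell ABC T none) k (org T h) (vec T h) := by
    obtain ⟨c, hc, h1⟩ := hl
    rw [ho, h1]
    exact germ_edgeVec ABC k s hc
  exact hT.not_three_germs (by simpa using hp.1) (by simp) (by simp)
    (germ_of_sameDir ABC rfl (.refl _)) (germ_of_sameDir ABC hp.2.1.symm hp.2.2.symm) hg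

/-! ### Parity of the number of half-edges at a vertex -/

open Classical in
/-- The half-edges of type `x` beginning at the point `P`. -/
def atPoint (T : Fin N → Tri) (x : Fin 3) (P : Plane) : Finset (HalfEdge N) :=
  Finset.univ.filter fun h => h.2.1 = x ∧ org T h = P

/-- A half-edge is unmatched if it has a partner, and this partner is of a different type. -/
def IsUnmatched (T : Fin N → Tri) (h : HalfEdge N) : Prop :=
  ∃ h', Partner T h h' ∧ h'.2.1 ≠ h.2.1

lemma mem_atPoint {x : Fin 3} {P : Plane} {h : HalfEdge N} :
    h ∈ atPoint T x P ↔ h.2.1 = x ∧ org T h = P := by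
  simp [atPoint]

lemma card_atPoint (T : Fin N → Tri) (x : Fin 3) (P : Plane) :
    (atPoint T x P).card = cnt T (x + 1) P + cnt T (x + 2) P := by
  classical
  have h : atPoint T x P =
      (Finset.univ.filter fun n => P = (T n).points (x + 1)).image (fun n => (n, x, true)) ∪
      (Finset.univ.filter fun n => P = (T n).points (x + 2)).image (fun n => (n, x, false)) := by
    ext ⟨n, k, s⟩
    rw [mem_atPoint]
    simp only [org, Finset.mem_union, Finset.mem_image, Finset.mem_filter, Finset.mem_univ,
      true_and, Prod.mk.injEq]
    constructor
    · rintro ⟨rfl, h⟩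
      cases s
      · exact Or.inr ⟨n, h.symm, rfl, rfl, rfl⟩
      · exact Or.inl ⟨n, h.symm, rfl, rfl, rfl⟩
    · rintro (⟨m, h, rfl, rfl, rfl⟩ | ⟨m, h, rfl, rfl, rfl⟩)
      · exact ⟨rfl, h.symm⟩
      · exact ⟨rfl, h.symm⟩
  rw [h, Finset.card_union_of_disjoint, Finset.card_image_of_injective,
    Finset.card_image_of_injective]
  · rfl
  · intro m n h; exact (Prod.mk.inj h).1
  · intro m n h; exact (Prod.mk.inj h).1
  · rw [Finset.disjoint_left]
    intro h h1 h2
    obtain ⟨m, -, rfl⟩ := Finset.mem_image.1 h1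
    obtain ⟨n, -, h3⟩ := Finset.mem_image.1 h2
    simp at h3

open Classical in
/-- The half-edges of type `x` at a point that have a partner of type `x` come in pairs. -/
lemma IsTiling.even_matched (hT : IsTiling ABC R T) (x : Fin 3) (P : Plane) :
    Even ((atPoint T x P).filter fun h => ∃ h', Partner T h h' ∧ h'.2.1 = x).card := by
  set M := (atPoint T x P).filter fun h => ∃ h', Partner T h h' ∧ h'.2.1 = x with hM
  have hsp : ∀ h ∈ M, ∃ h', Partner T h h' ∧ h'.2.1 = x := fun h hh => (Finset.mem_filter.1 hh).2
  choose! φ hφ using hsp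
  have hmem : ∀ h ∈ M, φ h ∈ M := by
    intro h hh
    have h1 := mem_atPoint.1 (Finset.mem_filter.1 hh).1
    refine Finset.mem_filter.2 ⟨mem_atPoint.2 ⟨(hφ h hh).2, ?_⟩, h, (hφ h hh).1.symm, h1.1⟩
    rw [← (hφ h hh).1.2.1, h1.2]
  have hz : ∑ _h ∈ M, (1 : ZMod 2) = 0 := by
    refine Finset.sum_involution (fun h _ => φ h) ?_ ?_ ?_ ?_
    · intro h _; decide
    · intro h hh _ he
      exact (hφ h hh).1.1 (by rw [he])
    · exact hmem
    · intro h hh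
      exact hT.partner_unique (hφ _ (hmem h hh)).1 (hφ h hh).1.symm
  rw [Finset.sum_const, nsmul_eq_mul, mul_one] at hz
  exact (ZMod.natCast_eq_zero_iff_even).1 hz

open Classical in
/-- The half-edges of type `x` at a point that have no partner at all. -/
def lone (T : Fin N → Tri) (x : Fin 3) (P : Plane) : Finset (HalfEdge N) :=
  (atPoint T x P).filter fun h => ∀ h', ¬ Partner T h h'

/-- Without unmatched half-edges of type `x` at `P`, the number of half-edges of type `x` at `P` has
the parity of the number of those without partner. -/
lemma IsTiling.even_card_add_lone (hT : IsTiling ABC R T) {x : Fin 3} {P : Plane}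
    (hno : ∀ h, h.2.1 = x → org T h = P → ¬ IsUnmatched T h) :
    Even ((atPoint T x P).card + (lone T x P).card) := by
  classical
  have h1 := Finset.card_filter_add_card_filter_not (s := atPoint T x P)
    (fun h => ∀ h', ¬ Partner T h h')
  have h2 : ((atPoint T x P).filter fun h => ¬ ∀ h', ¬ Partner T h h') =
      (atPoint T x P).filter fun h => ∃ h', Partner T h h' ∧ h'.2.1 = x := by
    refine Finset.filter_congr fun h hh => ?_
    obtain ⟨h3, h4⟩ := mem_atPoint.1 hh
    push Not
    constructor
    · rintro ⟨h', hp⟩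
      refine ⟨h', hp, ?_⟩
      by_contra hne
      exact hno h h3 h4 ⟨h', hp, by rwa [h3]⟩
    · rintro ⟨h', hp, -⟩; exact ⟨h', hp⟩
  rw [h2] at h1
  have h3 := hT.even_matched x P
  rw [← h1]
  change Even ((lone T x P).card + _ + (lone T x P).card)
  rw [add_right_comm]
  exact (Even.add_self _).add h3

lemma sameDir_or_neg_of_linear_eq_zero {t : Tri} {k : Fin 3} {v w : Plane} (hv : v ≠ 0) (hw : w ≠ 0)
    (h1 : (coord t k).linear v = 0) (h2 : (coord t k).linear w = 0) :
    SameDir w v ∨ SameDir w (-v) := by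
  have e1 := eq_smul_edgeVec t k true h1
  have e2 := eq_smul_edgeVec t k true h2
  set a := (coord t (startIdx k (!true))).linear v
  set b := (coord t (startIdx k (!true))).linear w
  set e := edgeVec t k true
  have ha : a ≠ 0 := by rintro h; rw [h, zero_smul] at e1; exact hv e1
  have hb : b ≠ 0 := by rintro h; rw [h, zero_smul] at e2; exact hw e2
  rcases lt_or_gt_of_ne (div_ne_zero ha hb) with h | h
  · refine Or.inr ⟨-(a / b), by linarith, ?_⟩
    rw [e2, smul_smul, neg_mul, div_mul_cancel₀ _ hb, neg_smul, ← e1]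
  · refine Or.inl ⟨a / b, h, ?_⟩
    rw [e2, smul_smul, div_mul_cancel₀ _ hb, ← e1]

lemma SameDir.linear_eq_zero {t : Tri} {k : Fin 3} {v w : Plane} (h : SameDir v w)
    (hv : (coord t k).linear v = 0) : (coord t k).linear w = 0 := by
  obtain ⟨c, -, rfl⟩ := h
  simp [hv]

lemma IsTiling.not_corner_of_onEdge_cell (hT : IsTiling ABC R T) {P : Plane}
    {o : Option (Fin N)} {k : Fin 3} (ho : OnEdge (cell ABC T o) k P) (j : Fin 3) :
    P ≠ ABC.points j := by
  rcases o with _ | n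
  · exact ho.ne_point j
  · exact hT.not_corner_of_onEdge ho

/-- If along an edge passing through a vertex the type changes from `x` to another one, and if the
number of half-edges of type `x` there is even, then one of them is unmatched. -/
lemma IsTiling.exists_unmatched_of_switch (hT : IsTiling ABC R T) {x : Fin 3} {P : Plane}
    {o : Option (Fin N)} {k : Fin 3} (ho : OnEdge (cell ABC T o) k P) {h₁ h₂ : HalfEdge N}
    (ho₁ : org T h₁ = P) (ho₂ : org T h₂ = P)
    (hl : (coord (cell ABC T o) k).linear (vec T h₁) = 0) (hd : SameDir (vec T h₂) (-vec T h₁))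
    (hx₁ : h₁.2.1 = x) (hx₂ : h₂.2.1 ≠ x) (hev : Even (cnt T (x + 1) P + cnt T (x + 2) P)) :
    ∃ h, h.2.1 = x ∧ org T h = P ∧ IsUnmatched T h := by
  by_contra! hno
  have h1 := hT.even_card_add_lone hno
  have hv : IsVertex T P := ho₁ ▸ isVertex_org T h₁
  have hne : ∀ g : HalfEdge N, org T g = P → some g.1 ≠ o := by
    rintro g hg rfl
    exact ho.ne_point _ hg.symm
  have h2 : lone T x P = {h₁} := by
    ext g
    simp only [lone, Finset.mem_filter, mem_atPoint, Finset.mem_singleton]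
    constructor
    · rintro ⟨⟨hgx, hgP⟩, hgp⟩
      rcases hT.exists_partner g with ⟨g', hg'⟩ | ⟨o', k', ho', hl'⟩ | ⟨k', s, hk', -⟩
      · exact absurd hg' (hgp g')
      · rw [hgP] at ho'
        have hoo : o' = o := by
          by_contra hoo
          exact hT.not_isVertex hoo ho' ho hv
        subst hoo
        obtain rfl := ho'.unique ho
        rcases sameDir_or_neg_of_linear_eq_zero (vec_ne_zero T h₁) (vec_ne_zero T g) hl hl'
          with h | h
        · exact hT.eq_of_germ (germ_of_onEdge ho hl) hgP ho₁ h (.refl _) (hne g hgP) (hne h₁ ho₁)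
        · have : g = h₂ := hT.eq_of_germ (v := -vec T h₁) (germ_of_onEdge ho (by simpa using hl))
            hgP ho₂ h hd (hne g hgP) (hne h₂ ho₂)
          exact absurd (this ▸ hgx) hx₂
      · exact absurd (hgP ▸ hk') (hT.not_corner_of_onEdge_cell ho _)
    · rintro rfl
      refine ⟨⟨hx₁, ho₁⟩, fun g' => ?_⟩
      exact hT.not_partner_flat (ho₁.symm ▸ ho) hl
  rw [card_atPoint, h2, Finset.card_singleton] at h1
  exact (Nat.not_even_iff_odd.2 hev.add_one) h1

/-- A vertex that is on no edge and not a corner of `ABC` is the beginning of an unmatched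
half-edge of type `x` if the number of half-edges of type `x` there is odd. -/
lemma IsTiling.exists_unmatched_of_odd (hT : IsTiling ABC R T) {x : Fin 3} {P : Plane}
    (h : ∀ o k, ¬ OnEdge (cell ABC T o) k P) (h' : ∀ j, P ≠ ABC.points j)
    (hodd : Odd (cnt T (x + 1) P + cnt T (x + 2) P)) :
    ∃ h, h.2.1 = x ∧ org T h = P ∧ IsUnmatched T h := by
  by_contra! hno
  have h1 := hT.even_card_add_lone hno
  have h2 : lone T x P = ∅ := by
    rw [Finset.eq_empty_iff_forall_notMem]
    intro g hg
    simp only [lone, Finset.mem_filter, mem_atPoint] at hg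
    obtain ⟨⟨hgx, hgP⟩, hgp⟩ := hg
    rcases hT.exists_partner g with ⟨g', hg'⟩ | ⟨o', k', ho', hl'⟩ | ⟨k', s, hk', -⟩
    · exact absurd hg' (hgp g')
    · exact h o' k' (hgP ▸ ho')
    · exact h' _ (hgP ▸ hk')
  rw [card_atPoint, h2, Finset.card_empty, add_zero] at h1
  exact (Nat.not_even_iff_odd.2 hodd) h1

/-- If no half-edge of type `x` is unmatched at a corner of `ABC` and both sides of `ABC` begin
there with half-edges of type `x`, then the number of half-edges of type `x` there is even. -/
lemma IsTiling.even_corner (hT : IsTiling ABC R T) {x j : Fin 3}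
    (hno : ∀ h, h.2.1 = x → org T h = ABC.points j → ¬ IsUnmatched T h)
    (hbd : ∀ h k s, startIdx k s = j → org T h = ABC.points j →
      SameDir (vec T h) (edgeVec ABC k s) → h.2.1 = x) :
    Even (cnt T (x + 1) (ABC.points j) + cnt T (x + 2) (ABC.points j)) := by
  classical
  have h1 := hT.even_card_add_lone hno
  have e1 : startIdx (j + 1) false = j := by fin_cases j <;> rfl
  have e2 : startIdx (j + 2) true = j := by fin_cases j <;> rfl
  obtain ⟨g₁, hg₁, hd₁⟩ := hT.exists_halfEdge_corner (j + 1) false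
  obtain ⟨g₂, hg₂, hd₂⟩ := hT.exists_halfEdge_corner (j + 2) true
  rw [e1] at hg₁
  rw [e2] at hg₂
  have germ : ∀ k s, startIdx k s = j → Germ (cell ABC T none) k (ABC.points j) (edgeVec ABC k s) :=
    fun k s hks => by simpa [hks] using germ_edgeVec ABC k s one_pos
  have hne : g₁ ≠ g₂ := by
    rintro rfl
    obtain ⟨c, hc, h3⟩ := hd₁.symm.trans hd₂
    have h4 := germ_edgeVec ABC (j + 1) false hc
    rw [← h3, e1] at h4
    have h5 := Germ.unique h4 (germ (j + 2) true e2)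
    simp at h5
  have h2 : lone T x (ABC.points j) = {g₁, g₂} := by
    ext g
    simp only [lone, Finset.mem_filter, mem_atPoint, Finset.mem_insert, Finset.mem_singleton]
    constructor
    · rintro ⟨⟨hgx, hgP⟩, hgp⟩
      rcases hT.exists_partner g with ⟨g', hg'⟩ | ⟨o', k', ho', hl'⟩ | ⟨k', s, hk', hd⟩
      · exact absurd hg' (hgp g')
      · exact absurd hgP (hT.not_corner_of_onEdge_cell ho' _)
      · rw [hgP] at hk'
        have hj : startIdx k' s = j := ABC.independent.injective hk'.symm
        have hks : (k' = j + 1 ∧ s = false) ∨ (k' = j + 2 ∧ s = true) := by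
          rw [← hj]
          cases s <;> fin_cases k' <;> simp [startIdx]
        rcases hks with ⟨rfl, rfl⟩ | ⟨rfl, rfl⟩
        · exact Or.inl (hT.eq_of_germ (germ _ _ e1) hgP hg₁ hd.symm hd₁ (by simp) (by simp))
        · exact Or.inr (hT.eq_of_germ (germ _ _ e2) hgP hg₂ hd.symm hd₂ (by simp) (by simp))
    · rintro (rfl | rfl)
      · exact ⟨⟨hbd g (j + 1) false e1 hg₁ hd₁, hg₁⟩, fun g' =>
          hT.not_partner_corner (hg₁.trans (by rw [e1])) hd₁.symm⟩
      · exact ⟨⟨hbd g (j + 2) true e2 hg₂ hd₂, hg₂⟩, fun g' =>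
          hT.not_partner_corner (hg₂.trans (by rw [e2])) hd₂.symm⟩
  rw [card_atPoint, h2, Finset.card_pair hne] at h1
  simpa [Nat.even_add] using h1

/-! ### Chains of edges of a free type -/

lemma onEdge_add_smul_edgeVec_iff (t : Tri) (k : Fin 3) (s : Bool) (ε : ℝ) :
    OnEdge t k (t.points (startIdx k s) + ε • edgeVec t k s) ↔ 0 < ε ∧ ε < 1 := by
  refine ⟨fun h => ?_, fun h => onEdge_add_smul_edgeVec t k s h.1 h.2⟩
  obtain ⟨e0, e1, e2⟩ := linear_edgeVec t k s
  rw [onEdge_iff t k s] at h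
  simp only [coord_add_smul, e0, e1, e2, coord_self] at h
  rw [coord_of_ne t (startIdx_ne k s).symm, coord_of_ne t (startIdx_not_ne k s)] at h
  exact ⟨by linarith [h.2.2], by linarith [h.2.1]⟩

lemma coord_sub_eq (t : Tri) (k : Fin 3) (P Q : Plane) :
    coord t k Q = coord t k P + (coord t k).linear (Q - P) := by
  rw [coord_linear_sub]; ring

/-- Two tiles that meet along edges lie on opposite sides of their common line. -/
lemma IsTiling.opposite_sides (hT : IsTiling ABC R T) {m n : Fin N} (hmn : m ≠ n) {k k' : Fin 3}
    {Q : Plane} (hm : OnEdge (T m) k Q) (hn : OnEdge (T n) k' Q) :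
    ∃ κ : ℝ, 0 < κ ∧ ∀ Q', coord (T m) k Q' = -κ * coord (T n) k' Q' := by
  set f := (coord (T m) k).linear with hf
  set g := (coord (T n) k').linear with hg
  have hnot : ∀ w, ¬ (0 < f w ∧ 0 < g w) := by
    rintro w ⟨hfw, hgw⟩
    have hin : ∀ (t : Tri) (j : Fin 3), OnEdge t j Q → 0 < (coord t j).linear w →
        ∀ᶠ ε in 𝓝[>] (0 : ℝ), Q + ε • w ∈ t.interior := by
      intro t j hj hw
      have hc : ∀ i, ContinuousAt (fun ε : ℝ => coord t i Q + ε * (coord t i).linear w) 0 :=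
        fun i => by fun_prop
      have hpos : ∀ i, 0 < coord t i Q → ∀ᶠ ε in 𝓝[>] (0 : ℝ), 0 < coord t i (Q + ε • w) := by
        intro i hi
        simp only [coord_add_smul]
        exact ((hc i).eventually (lt_mem_nhds (by simpa using hi))).filter_mono nhdsWithin_le_nhds
      filter_upwards [hpos _ hj.2.1, hpos _ hj.2.2, self_mem_nhdsWithin] with ε h1 h2 h3
      rw [mem_interior_iff, forall_fin_three j]
      refine ⟨?_, h1, h2⟩
      rw [coord_add_smul, hj.1, zero_add]
      exact mul_pos h3 hw
    obtain ⟨ε, h1, h2⟩ := ((hin _ _ hm hfw).and (hin _ _ hn hgw)).exists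
    exact disjoint_left.1 (hT.nonoverlapping hmn) h1 h2
  set u := edgeVec (T n) k' true
  have hgu : g u = 0 := (linear_edgeVec (T n) k' true).1
  set p := (T n).points k' - Q
  have hgp : g p = 1 := by
    rw [hg, coord_linear_sub, coord_self, hn.1, sub_zero]
  have hfu : f u = 0 := by
    by_contra hne
    apply hnot (p + ((1 - f p) / f u) • u)
    simp only [map_add, map_smul, smul_eq_mul, hgu, hgp, mul_zero]
    rw [div_mul_cancel₀ _ hne]
    norm_num
  have hfg : ∀ w, f w = f p * g w := by
    intro w
    have h1 : g (w - g w • p) = 0 := by simp [hgp]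
    have h2 := eq_smul_edgeVec (T n) k' true h1
    have h3 : f (w - g w • p) = 0 := by
      rw [h2, map_smul, hfu, smul_zero]
    rw [map_sub, map_smul, smul_eq_mul] at h3
    linarith
  have hfp0 : f p ≠ 0 := by
    intro h
    apply coord_linear_ne_zero (T m) k
    ext1 w
    have := hfg w
    rw [h, zero_mul] at this
    simpa using this
  have hfp : f p < 0 := by
    refine lt_of_le_of_ne (not_lt.1 fun h => hnot p ⟨h, ?_⟩) hfp0
    rw [hgp]; exact one_pos
  refine ⟨-f p, by linarith, fun Q' => ?_⟩
  rw [coord_sub_eq (T m) k Q Q', coord_sub_eq (T n) k' Q Q', hm.1, hn.1, zero_add, zero_add,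
    ← hf, ← hg, hfg]
  ring

/-- Lengths of finitely many disjoint intervals that fill an interval up to finitely many points. -/
lemma sum_lengths {ι : Type*} (s : Finset ι) (lo hi : ι → ℝ) {K : ℝ} (hK : 0 ≤ K)
    (h : ∀ i ∈ s, 0 ≤ lo i ∧ lo i ≤ hi i ∧ hi i ≤ K)
    (hd : ∀ i ∈ s, ∀ j ∈ s, i ≠ j → Disjoint (Ioo (lo i) (hi i)) (Ioo (lo j) (hi j)))
    {F : Set ℝ} (hF : F.Finite) (hc : ∀ τ ∈ Ioo 0 K, τ ∉ F → ∃ i ∈ s, τ ∈ Ioo (lo i) (hi i)) :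
    ∑ i ∈ s, (hi i - lo i) = K := by
  have h1 : volume (⋃ i ∈ s, Ioo (lo i) (hi i)) = ∑ i ∈ s, volume (Ioo (lo i) (hi i)) :=
    measure_biUnion_finset (fun i hi j hj hij => hd i hi j hj hij) fun i _ => measurableSet_Ioo
  have h2 : volume (⋃ i ∈ s, Ioo (lo i) (hi i)) = ENNReal.ofReal K := by
    apply le_antisymm
    · calc volume (⋃ i ∈ s, Ioo (lo i) (hi i)) ≤ volume (Ioo 0 K) := by
            apply measure_mono
            simp only [iUnion_subset_iff]
            exact fun i hi => Ioo_subset_Ioo (h i hi).1 (h i hi).2.2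
        _ = ENNReal.ofReal K := by rw [Real.volume_Ioo, sub_zero]
    · calc ENNReal.ofReal K = volume (Ioo 0 K) := by rw [Real.volume_Ioo, sub_zero]
        _ ≤ volume ((⋃ i ∈ s, Ioo (lo i) (hi i)) ∪ F) := by
            apply measure_mono
            intro τ hτ
            by_cases hτF : τ ∈ F
            · exact Or.inr hτF
            · obtain ⟨i, hi, hτi⟩ := hc τ hτ hτF
              exact Or.inl (mem_biUnion hi hτi)
        _ ≤ volume (⋃ i ∈ s, Ioo (lo i) (hi i)) + volume F := measure_union_le _ _
        _ = volume (⋃ i ∈ s, Ioo (lo i) (hi i)) := by rw [hF.measure_zero, add_zero]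
  rw [h2] at h1
  simp only [Real.volume_Ioo] at h1
  rw [← ENNReal.ofReal_sum_of_nonneg (fun i hi => by linarith [(h i hi).2.1]),
    ENNReal.ofReal_eq_ofReal_iff hK
      (Finset.sum_nonneg fun i hi => by linarith [(h i hi).2.1])] at h1
  exact h1.symm

/-- The edge `k` of the triangle `t` lies on the line through the half-edge `h`; the sign of `c`
tells on which side of it `t` lies. -/
def OnLine (T : Fin N → Tri) (h : HalfEdge N) (t : Tri) (k : Fin 3) (c : ℝ) : Prop :=
  ∀ Q, coord t k Q = c * coord (T h.1) h.2.1 Q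

lemma OnLine.linear {h : HalfEdge N} {t : Tri} {k : Fin 3} {c : ℝ} (hl : OnLine T h t k c)
    (w : Plane) : (coord t k).linear w = c * (coord (T h.1) h.2.1).linear w := by
  have h1 := coord_sub_eq t k (org T h) (org T h + w)
  have h2 := coord_sub_eq (T h.1) h.2.1 (org T h) (org T h + w)
  rw [hl, hl, h2] at h1
  rw [add_sub_cancel_left] at h1
  linarith

lemma linear_vec (T : Fin N → Tri) (h : HalfEdge N) : (coord (T h.1) h.2.1).linear (vec T h) = 0 :=
  (linear_edgeVec _ _ _).1

lemma coord_org (T : Fin N → Tri) (h : HalfEdge N) : coord (T h.1) h.2.1 (org T h) = 0 :=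
  coord_of_ne _ (startIdx_ne _ _).symm

/-- An edge on the line of `h` occupies an interval in the parametrization of this line by
`org T h + τ • vec T h`. -/
lemma OnLine.exists_interval {h : HalfEdge N} {t : Tri} {k : Fin 3} {c : ℝ} (hc : c ≠ 0)
    (hl : OnLine T h t k c) : ∃ lo hi : ℝ, lo < hi ∧
      (∀ τ : ℝ, OnEdge t k (org T h + τ • vec T h) ↔ τ ∈ Ioo lo hi) ∧
      side t k = (hi - lo) * side (T h.1) h.2.1 := by
  have hr : ∀ s, ∃ r : ℝ, edgeVec t k s = r • vec T h := by
    intro s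
    have h1 := hl.linear (edgeVec t k s)
    rw [(linear_edgeVec t k s).1] at h1
    have h2 : (coord (T h.1) h.2.1).linear (edgeVec t k s) = 0 := by
      simpa [hc] using h1.symm
    exact ⟨_, eq_smul_edgeVec _ _ h.2.2 h2⟩
  have hpos : ∃ s, ∃ r : ℝ, 0 < r ∧ edgeVec t k s = r • vec T h := by
    obtain ⟨r, h1⟩ := hr true
    have hr0 : r ≠ 0 := by
      rintro rfl
      exact edgeVec_ne_zero t k true (by rw [h1, zero_smul])
    rcases lt_or_gt_of_ne hr0 with h2 | h2
    · exact ⟨false, -r, by linarith, by rw [neg_smul, ← h1, ← edgeVec_not]; rfl⟩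
    · exact ⟨true, r, h2, h1⟩
  obtain ⟨s, r, hr0, hrs⟩ := hpos
  have hA : ∃ lo : ℝ, t.points (startIdx k s) = org T h + lo • vec T h := by
    have h1 : coord t k (t.points (startIdx k s)) = 0 := coord_of_ne _ (startIdx_ne k s).symm
    rw [hl] at h1
    have h2 : coord (T h.1) h.2.1 (t.points (startIdx k s)) = 0 := by simpa [hc] using h1
    have h3 := coord_linear_sub (T h.1) h.2.1 (org T h) (t.points (startIdx k s))
    rw [h2, coord_org, sub_zero] at h3
    have h4 := eq_smul_edgeVec _ _ h.2.2 h3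
    exact ⟨_, eq_add_of_sub_eq' h4⟩
  obtain ⟨lo, hlo⟩ := hA
  refine ⟨lo, lo + r, by linarith, fun τ => ?_, ?_⟩
  · have e : org T h + τ • vec T h =
        t.points (startIdx k s) + ((τ - lo) / r) • edgeVec t k s := by
      rw [hlo, hrs, smul_smul, div_mul_cancel₀ _ hr0.ne', sub_smul]; abel
    rw [e, onEdge_add_smul_edgeVec_iff, div_lt_one hr0, mem_Ioo]
    constructor
    · rintro ⟨h1, h2⟩
      have := (div_pos_iff_of_pos_right hr0).1 h1
      exact ⟨by linarith, by linarith⟩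
    · rintro ⟨h1, h2⟩
      exact ⟨div_pos (by linarith) hr0, by linarith⟩
  · rw [← norm_edgeVec t k s, hrs, norm_smul, Real.norm_of_nonneg hr0.le, vec, norm_edgeVec]
    ring

/-- Edges of the type of `h`, on the same side of its line as `h`, follow each other from the
beginning of `h` up to `K` times its length. -/
def Chain (T : Fin N → Tri) (h : HalfEdge N) (K : ℕ) : Prop :=
  ∀ j < K, ∃ g : HalfEdge N, g.2.1 = h.2.1 ∧ org T g = org T h + (j : ℝ) • vec T h ∧
    vec T g = vec T h ∧ ∃ κ : ℝ, 0 < κ ∧ OnLine T h (T g.1) h.2.1 κ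

lemma Chain.mono {h : HalfEdge N} {K K' : ℕ} (hc : Chain T h K) (hK : K' ≤ K) : Chain T h K' :=
  fun j hj => hc j (hj.trans_le hK)

lemma chain_one (h : HalfEdge N) : Chain T h 1 := by
  intro j hj
  obtain rfl : j = 0 := by omega
  exact ⟨h, rfl, by simp, rfl, 1, one_pos, fun Q => by rw [one_mul]⟩

/-- The side of type `x` is free if its multiples are sums of sides in the trivial way only. -/
def Free (R : Tri) (x : Fin 3) : Prop :=
  ∀ (K : ℕ) (c : Fin 3 → ℕ), (K : ℝ) * side R x = ∑ k, (c k : ℝ) * side R k →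
    ∀ k ≠ x, c k = 0

lemma side_pos (t : Tri) (k : Fin 3) : 0 < side t k :=
  dist_pos.2 (points_ne t (by simp))

lemma Partner.opposite_sides (hT : IsTiling ABC R T) {h h' : HalfEdge N} (hp : Partner T h h') :
    ∃ κ : ℝ, 0 < κ ∧ OnLine T h (T h'.1) h'.2.1 (-κ) := by
  have g := germ_of_sameDir ABC (T := T) (h := h) rfl (.refl _)
  have g' := germ_of_sameDir ABC (h := h') hp.2.1.symm hp.2.2.symm
  obtain ⟨ε, h1, h2⟩ := (Eventually.and g g').exists
  exact hT.opposite_sides hp.1.symm h2 h1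

/-- The points of a chain beginning with a half-edge that has a partner are interior points of
`ABC`. -/
lemma Chain.mem_interior (hT : IsTiling ABC R T) {h h' : HalfEdge N} (hp : Partner T h h') {K : ℕ}
    (hc : Chain T h K) (hK : 1 ≤ K) {τ : ℝ} (hτ : τ ∈ Ioo 0 (K : ℝ)) :
    org T h + τ • vec T h ∈ ABC.interior := by
  have hP : org T h ∈ ABC.closedInterior := hT.subset h.1 ((T h.1).point_mem_closedInterior _)
  have hW : org T h + (K : ℝ) • vec T h ∈ ABC.closedInterior := by
    obtain ⟨g, hg1, hg2, hg3, -⟩ := hc (K - 1) (by omega)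
    have : org T h + (K : ℝ) • vec T h = (T g.1).points (startIdx g.2.1 (!g.2.2)) := by
      have h1 : org T g + vec T g = (T g.1).points (startIdx g.2.1 (!g.2.2)) := by
        simp [org, vec, edgeVec]
      rw [← h1, hg2, hg3, Nat.cast_sub hK]
      simp [sub_smul, add_assoc]
    rw [this]
    exact hT.subset g.1 ((T g.1).point_mem_closedInterior _)
  have hnear : ∀ᶠ ε in 𝓝[>] (0 : ℝ), org T h + ε • vec T h ∈ ABC.interior := by
    have g := germ_of_sameDir ABC (T := T) (h := h) rfl (.refl _)
    have g' := germ_of_sameDir ABC (h := h') hp.2.1.symm hp.2.2.symm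
    filter_upwards [g, g', eventually_not_isVertex T (org T h) (vec_ne_zero T h)] with ε h1 h2 h3
    have hmem : org T h + ε • vec T h ∈ ABC.closedInterior :=
      hT.subset h.1 h1.mem_closedInterior
    rcases cases_of_mem_closedInterior hmem with h4 | ⟨k, h4⟩ | ⟨i, h4⟩
    · exact h4
    · exact (hT.not_three (o₁ := none) (o₂ := some h.1) (o₃ := some h'.1) (by simp) (by simp)
        (by simpa using hp.1) h4 h1 h2).elim
    · exact absurd h4 (hT.ne_point_of_not_isVertex h3 none i)
  have hτK : 0 < min τ (K - τ) := lt_min hτ.1 (by linarith [hτ.2])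
  obtain ⟨ε, h1, h2, h3⟩ := (hnear.and (Ioo_mem_nhdsGT hτK)).exists
  rw [mem_closedInterior_iff] at hP hW
  rw [mem_interior_iff] at h1 ⊢
  intro k
  have hPk := hP k
  have hWk := hW k
  have h1k := h1 k
  rw [coord_add_smul] at hWk h1k ⊢
  set a := coord ABC k (org T h)
  set b := (coord ABC k).linear (vec T h)
  have h4 : ε < τ := h3.trans_le (min_le_left _ _)
  have h5 : τ < K := hτ.2
  rcases le_or_gt 0 b with hb | hb
  · nlinarith
  · have : τ * b > K * b := by nlinarith
    linarith

/-- The run lemma: the other side of a chain of free edges of type `x` that begins with an unmatched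
half-edge has an edge passing through the end of the chain. Otherwise the edges on the other side
would add up to a multiple of the free side, although the first of them is of a different type. -/
lemma Chain.exists_crossing (hT : IsTiling ABC R T) {h h' : HalfEdge N} (hfree : Free R h.2.1)
    (hp : Partner T h h') (hx : h'.2.1 ≠ h.2.1) {K : ℕ} (hc : Chain T h K) (hK : 1 ≤ K) :
    ∃ m k, ∃ κ : ℝ, 0 < κ ∧ OnLine T h (T m) k (-κ) ∧
      OnEdge (T m) k (org T h + (K : ℝ) • vec T h) := by
  classical
  by_contra! hno
  set P := org T h with hP
  set v := vec T h with hv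
  have hK0 : (0 : ℝ) < K := by exact_mod_cast hK
  set E : Finset (Fin N × Fin 3) := Finset.univ.filter fun e =>
    (∃ κ : ℝ, 0 < κ ∧ OnLine T h (T e.1) e.2 (-κ)) ∧
      ∃ τ ∈ Ioo 0 (K : ℝ), OnEdge (T e.1) e.2 (P + τ • v) with hE
  have hint : ∀ e ∈ E, ∃ lo hi : ℝ, lo < hi ∧
      (∀ τ : ℝ, OnEdge (T e.1) e.2 (P + τ • v) ↔ τ ∈ Ioo lo hi) ∧
      side (T e.1) e.2 = (hi - lo) * side (T h.1) h.2.1 := by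
    intro e he
    obtain ⟨⟨κ, hκ, hl⟩, -⟩ := (Finset.mem_filter.1 he).2
    exact hl.exists_interval (by linarith)
  choose! lo hi hlohi hiff hside using hint
  have hsub : ∀ e ∈ E, 0 ≤ lo e ∧ lo e ≤ hi e ∧ hi e ≤ K := by
    intro e he
    obtain ⟨⟨κ, hκ, hl⟩, τ, hτ, hτe⟩ := (Finset.mem_filter.1 he).2
    rw [hiff e he] at hτe
    refine ⟨?_, (hlohi e he).le, ?_⟩
    · by_contra hneg
      have h0 : OnEdge (T e.1) e.2 (P + (0 : ℝ) • v) :=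
        (hiff e he 0).2 ⟨not_le.1 hneg, hτ.1.trans hτe.2⟩
      rw [zero_smul, add_zero] at h0
      refine hT.not_partner_flat (o := some e.1) h0 ?_ hp
      rw [cell_some, hl.linear, linear_vec, mul_zero]
    · by_contra hneg
      exact hno e.1 e.2 κ hκ hl ((hiff e he K).2 ⟨hτe.1.trans hτ.2, not_le.1 hneg⟩)
  have hdisj : ∀ e ∈ E, ∀ e' ∈ E, e ≠ e' → Disjoint (Ioo (lo e) (hi e)) (Ioo (lo e') (hi e')) := by
    intro e he e' he' hne
    rw [Set.disjoint_left]
    intro τ h1 h2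
    rw [← hiff e he] at h1
    rw [← hiff e' he'] at h2
    obtain ⟨⟨κ, hκ, hl⟩, -⟩ := (Finset.mem_filter.1 he).2
    obtain ⟨⟨κ', hκ', hl'⟩, -⟩ := (Finset.mem_filter.1 he').2
    by_cases h3 : e.1 = e'.1
    · rw [h3] at h1
      exact hne (Prod.ext h3 (h1.unique h2))
    · obtain ⟨κ'', hκ'', h4⟩ := hT.opposite_sides h3 h1 h2
      have h5 := h4 ((T h.1).points h.2.1)
      rw [hl, hl', coord_self] at h5
      have : 0 < κ'' * κ' := by positivity
      linarith
  set F : Set ℝ := (fun τ : ℝ => P + τ • v) ⁻¹' {Q | IsVertex T Q} with hFdef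
  have hF : F.Finite := by
    apply Set.Finite.preimage
    · intro τ _ τ' _ h1
      exact smul_left_injective ℝ (vec_ne_zero T h) (add_left_cancel h1)
    · have : {Q | IsVertex T Q} = Set.range fun p : Fin N × Fin 3 => (T p.1).points p.2 := by
        ext Q; simp [IsVertex, eq_comm]
      rw [this]
      exact Set.finite_range _
  have hcover : ∀ τ ∈ Ioo 0 (K : ℝ), τ ∉ F → ∃ e ∈ E, τ ∈ Ioo (lo e) (hi e) := by
    intro τ hτ hτF
    have hj : ⌊τ⌋₊ < K := (Nat.floor_lt hτ.1.le).2 hτ.2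
    obtain ⟨g, hg1, hg2, hg3, κ, hκ, hgl⟩ := hc ⌊τ⌋₊ hj
    have hpt : P + τ • v = org T g + (τ - ⌊τ⌋₊) • vec T g := by
      rw [hg2, hg3, sub_smul]; abel
    have hg : OnEdge (T g.1) h.2.1 (P + τ • v) := by
      rw [hpt, ← hg1]
      refine onEdge_add_smul_edgeVec _ _ _ ?_ (by linarith [Nat.lt_floor_add_one τ])
      refine sub_pos.2 (lt_of_le_of_ne (Nat.floor_le hτ.1.le) fun h1 => hτF ?_)
      rw [h1, sub_self, zero_smul, add_zero] at hpt
      change IsVertex T (P + τ • v)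
      rw [hpt]
      exact isVertex_org T g
    obtain ⟨o', k', ho', hk'⟩ := hT.exists_opposite (o := some g.1) hτF hg
    have hin := hc.mem_interior hT hp hK hτ
    rcases o' with _ | m
    · exact absurd hin hk'.not_mem_interior
    · have hmg : m ≠ g.1 := by simpa using ho'
      obtain ⟨κ', hκ', h4⟩ := hT.opposite_sides hmg hk' hg
      have hmE : (m, k') ∈ E := by
        refine Finset.mem_filter.2 ⟨Finset.mem_univ _, ⟨κ' * κ, by positivity, fun Q => ?_⟩,
          τ, hτ, hk'⟩
        rw [h4, hgl]; ring
      exact ⟨(m, k'), hmE, (hiff _ hmE τ).1 hk'⟩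
  have hsum := sum_lengths E lo hi hK0.le hsub hdisj hF hcover
  -- Counting the edges by type turns the sum of lengths into a relation between the sides.
  have hrel : (K : ℝ) * side R h.2.1 =
      ∑ k, ((E.filter fun e => e.2 = k).card : ℝ) * side R k := by
    have h1 : ∑ e ∈ E, side R e.2 = (K : ℝ) * side R h.2.1 := by
      rw [← hsum, Finset.sum_mul]
      refine Finset.sum_congr rfl fun e he => ?_
      rw [← hT.side_eq e.1, hside e he, hT.side_eq]
    rw [← h1, ← Finset.sum_fiberwise E (fun e => e.2) (fun e => side R e.2)]
    refine Finset.sum_congr rfl fun k _ => ?_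
    rw [Finset.sum_congr rfl (g := fun _ => side R k)
      (fun e he => by rw [(Finset.mem_filter.1 he).2]), Finset.sum_const, nsmul_eq_mul]
  have hzero := hfree K _ hrel h'.2.1 hx
  rw [Finset.card_eq_zero, Finset.filter_eq_empty_iff] at hzero
  have hmem : (h'.1, h'.2.1) ∈ E := by
    obtain ⟨κ, hκ, hl⟩ := hp.opposite_sides hT
    refine Finset.mem_filter.2 ⟨Finset.mem_univ _, ⟨κ, hκ, hl⟩, ?_⟩
    have g' := germ_of_sameDir ABC (h := h') hp.2.1.symm hp.2.2.symm
    obtain ⟨ε, h1, h2⟩ := (Eventually.and g' (Ioo_mem_nhdsGT hK0)).exists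
    exact ⟨ε, h2, h1⟩
  exact hzero hmem rfl

/-! ### Runs and switches -/

/-- At the point `W`, in the relative interior of an edge of a tile, the type of the edges along
that edge changes from `x` to another one. -/
def IsSwitch (T : Fin N → Tri) (x : Fin 3) (W : Plane) : Prop :=
  ∃ m k h₁ h₂, OnEdge (T m) k W ∧ (coord (T m) k).linear (vec T h₁) = 0 ∧ org T h₁ = W ∧
    org T h₂ = W ∧ SameDir (vec T h₂) (-vec T h₁) ∧ h₁.2.1 = x ∧ h₂.2.1 ≠ x

lemma chain_bounded (T : Fin N → Tri) (h : HalfEdge N) : ∃ K, ¬ Chain T h K := by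
  refine ⟨Fintype.card (HalfEdge N) + 1, fun hc => ?_⟩
  choose g hg1 hg2 hg3 hg4 using hc
  have hinj : Function.Injective fun j : Fin (Fintype.card (HalfEdge N) + 1) => g j j.2 := by
    intro i j hij
    have h1 : org T h + ((i : ℕ) : ℝ) • vec T h = org T h + ((j : ℕ) : ℝ) • vec T h := by
      rw [← hg2 i i.2, ← hg2 j j.2]; exact congrArg (org T) hij
    have h2 := smul_left_injective ℝ (vec_ne_zero T h) (add_left_cancel h1)
    exact Fin.ext (by exact_mod_cast h2)
  simpa using Fintype.card_le_of_injective _ hinj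

/-- Following a run of free edges of type `x` that begins with an unmatched half-edge, one arrives
at a switch. -/
lemma IsTiling.exists_run_end (hT : IsTiling ABC R T) {h : HalfEdge N} (hfree : Free R h.2.1)
    (hu : IsUnmatched T h) : ∃ K : ℕ, 1 ≤ K ∧ Chain T h K ∧
      ∃ m k, OnEdge (T m) k (org T h + (K : ℝ) • vec T h) ∧
        (coord (T m) k).linear (vec T h) = 0 ∧
        (∃ g, org T g = org T h + (K : ℝ) • vec T h ∧ vec T g = -vec T h ∧ g.2.1 = h.2.1) ∧
        ∃ g, org T g = org T h + (K : ℝ) • vec T h ∧ SameDir (vec T g) (vec T h) ∧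
          g.2.1 ≠ h.2.1 := by
  classical
  obtain ⟨h', hp, hx⟩ := hu
  have hex := chain_bounded T h
  set K₁ := Nat.find hex with hK₁
  have hK₁2 : 2 ≤ K₁ := by
    by_contra hlt
    exact Nat.find_spec hex ((chain_one h).mono (by omega))
  obtain ⟨K, hK⟩ : ∃ K, K₁ = K + 1 := ⟨K₁ - 1, by omega⟩
  have hc : Chain T h K := by
    by_contra hcon
    have := Nat.find_min' hex hcon
    omega
  have hnc : ¬ Chain T h (K + 1) := hK ▸ Nat.find_spec hex
  have hK1 : 1 ≤ K := by omega
  obtain ⟨m, k, κ, hκ, hl, hm⟩ := hc.exists_crossing hT hfree hp hx hK1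
  have hlin : (coord (T m) k).linear (vec T h) = 0 := by rw [hl.linear, linear_vec, mul_zero]
  obtain ⟨g₁, hg₁1, hg₁2, hg₁3, -⟩ := hc (K - 1) (by omega)
  have hrev : org T (g₁.1, g₁.2.1, !g₁.2.2) = org T h + (K : ℝ) • vec T h := by
    have h1 : org T (g₁.1, g₁.2.1, !g₁.2.2) = org T g₁ + vec T g₁ := by
      simp [org, vec, edgeVec]
    rw [h1, hg₁2, hg₁3, Nat.cast_sub hK1]
    simp [sub_smul, add_assoc]
  have hrevv : vec T (g₁.1, g₁.2.1, !g₁.2.2) = -vec T h := by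
    rw [← hg₁3]; exact edgeVec_not _ _ _
  have hvert : IsVertex T (org T h + (K : ℝ) • vec T h) := hrev ▸ isVertex_org T _
  obtain ⟨g, hgm, hgW, hgd⟩ := hT.exists_halfEdge_flat (o := some m) hvert hm (vec_ne_zero T h) hlin
  refine ⟨K, hK1, hc, m, k, hm, hlin, ⟨_, hrev, hrevv, hg₁1⟩, g, hgW, hgd, fun hgx => hnc ?_⟩
  -- Otherwise the half-edge leaving the end of the chain would prolong it.
  have hgv : vec T g = vec T h := by
    obtain ⟨c, hc0, hcv⟩ := hgd
    have h1 : ‖vec T h‖ = c * ‖vec T g‖ := by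
      rw [hcv, norm_smul, Real.norm_of_nonneg hc0.le]
    have h2 : ‖vec T h‖ = side R h.2.1 := by rw [vec, norm_edgeVec, hT.side_eq]
    have h3 : ‖vec T g‖ = side R h.2.1 := by rw [vec, norm_edgeVec, hT.side_eq, hgx]
    rw [h2, h3] at h1
    have h4 := side_pos R h.2.1
    have h5 : c = 1 := by
      have : (c - 1) * side R h.2.1 = 0 := by linarith
      rcases mul_eq_zero.1 this with h6 | h6 <;> linarith
    rw [hcv, h5, one_smul]
  have hside : ∃ κ : ℝ, 0 < κ ∧ OnLine T h (T g.1) h.2.1 κ := by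
    have g1 := germ_of_sameDir ABC hgW hgd
    have g2 : Germ (cell ABC T (some m)) k (org T h + (K : ℝ) • vec T h) (vec T h) :=
      germ_of_onEdge hm hlin
    obtain ⟨ε, h1, h2⟩ := (Eventually.and g1 g2).exists
    obtain ⟨κ', hκ', h3⟩ := hT.opposite_sides (by simpa using hgm) h1 h2
    refine ⟨κ' * κ, by positivity, fun Q => ?_⟩
    rw [← hgx, h3, hl, hgx]; ring
  intro j hj
  rcases Nat.lt_succ_iff_lt_or_eq.1 hj with hj | rfl
  · exact hc j hj
  · exact ⟨g, hgx, hgW, hgv, hside⟩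

/-- Of two half-edges of type `x` in the same direction whose runs end at the same point, the run
of the second is not longer. -/
lemma IsTiling.run_length_le (hT : IsTiling ABC R T) {h h₀ : HalfEdge N} (hfree : Free R h.2.1)
    (hu : IsUnmatched T h) (hu₀ : IsUnmatched T h₀) (hv : vec T h = vec T h₀) {K K₀ : ℕ}
    (hc₀ : Chain T h₀ K₀)
    (hW : org T h + (K : ℝ) • vec T h = org T h₀ + (K₀ : ℝ) • vec T h₀)
    (hx : h.2.1 = h₀.2.1) : K₀ ≤ K := by
  by_contra hlt
  push Not at hlt
  obtain ⟨h', hp, -⟩ := hu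
  obtain ⟨h₀', hp₀, hx₀⟩ := hu₀
  have hP : org T h = org T h₀ + ((K₀ - K : ℕ) : ℝ) • vec T h₀ := by
    rw [Nat.cast_sub hlt.le, sub_smul, ← add_sub_assoc, ← hW, hv]; simp
  obtain ⟨m, k, κ, hκ, hl, hm⟩ := (hc₀.mono (Nat.sub_le K₀ K)).exists_crossing hT (hx ▸ hfree)
    hp₀ hx₀ (by omega)
  rw [← hP] at hm
  refine hT.not_partner_flat (o := some m) hm ?_ hp
  rw [cell_some, hl.linear, hv, linear_vec, mul_zero]

open Classical in
/-- The unmatched half-edges of type `x`. -/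
def unmatched (T : Fin N → Tri) (x : Fin 3) : Finset (HalfEdge N) :=
  Finset.univ.filter fun h => h.2.1 = x ∧ IsUnmatched T h

open Classical in
/-- The vertices of the tiling. -/
def vertices (T : Fin N → Tri) : Finset Plane :=
  Finset.univ.image fun p : Fin N × Fin 3 => (T p.1).points p.2

lemma mem_vertices {P : Plane} : P ∈ vertices T ↔ IsVertex T P := by
  simp [vertices, IsVertex, eq_comm]

open Classical in
/-- The points where, along an edge, the type changes from `x` to another one. -/
def switches (T : Fin N → Tri) (x : Fin 3) : Finset Plane :=
  (vertices T).filter (IsSwitch T x)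

/-- If the side of type `x` is free, then there are at most as many unmatched half-edges of
type `x` as switches: the map that sends a half-edge to the end of its run is injective. -/
lemma IsTiling.card_unmatched_le (hT : IsTiling ABC R T) {x : Fin 3} (hfree : Free R x) :
    (unmatched T x).card ≤ (switches T x).card := by
  classical
  have hend : ∀ h ∈ unmatched T x, ∃ K : ℕ, 1 ≤ K ∧ Chain T h K ∧
      ∃ m k, OnEdge (T m) k (org T h + (K : ℝ) • vec T h) ∧
        (coord (T m) k).linear (vec T h) = 0 ∧
        (∃ g, org T g = org T h + (K : ℝ) • vec T h ∧ vec T g = -vec T h ∧ g.2.1 = h.2.1) ∧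
        ∃ g, org T g = org T h + (K : ℝ) • vec T h ∧ SameDir (vec T g) (vec T h) ∧
          g.2.1 ≠ h.2.1 := by
    intro h hh
    obtain ⟨-, rfl, hu⟩ := Finset.mem_filter.1 hh
    exact hT.exists_run_end hfree hu
  choose! K hK1 hK using hend
  refine Finset.card_le_card_of_injOn (fun h => org T h + (K h : ℝ) • vec T h) ?_ ?_
  · intro h hh
    obtain ⟨-, hx, hu⟩ := Finset.mem_filter.1 hh
    obtain ⟨-, m, k, hm, hl, ⟨g₁, hg₁, hv₁, hx₁⟩, g₂, hg₂, hv₂, hx₂⟩ := hK h hh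
    have hvert : IsVertex T (org T h + (K h : ℝ) • vec T h) := hg₁ ▸ isVertex_org T g₁
    refine Finset.mem_coe.2 (Finset.mem_filter.2 ⟨mem_vertices.2 hvert,
      m, k, g₁, g₂, hm, by rw [hv₁, map_neg, hl, neg_zero], hg₁, hg₂, ?_, hx₁.trans hx, ?_⟩)
    · rwa [hv₁, neg_neg]
    · rwa [← hx]
  · intro h hh h₀ hh₀ hW
    rw [Finset.mem_coe] at hh hh₀
    obtain ⟨-, hx, hu⟩ := Finset.mem_filter.1 hh
    obtain ⟨-, hx₀, hu₀⟩ := Finset.mem_filter.1 hh₀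
    obtain ⟨hc, m, k, hm, hl, ⟨g₁, hg₁, hv₁, hx₁⟩, g₂, hg₂, hv₂, hx₂⟩ := hK h hh
    obtain ⟨hc₀, m₀, k₀, hm₀, hl₀, ⟨g₃, hg₃, hv₃, hx₃⟩, g₄, hg₄, hv₄, hx₄⟩ := hK h₀ hh₀
    simp only at hW
    rw [← hW] at hm₀ hg₃ hg₄
    have hvert : IsVertex T (org T h + (K h : ℝ) • vec T h) := hg₁ ▸ isVertex_org T g₁
    obtain rfl : m = m₀ := by
      by_contra hne
      exact hT.not_isVertex (o₁ := some m) (o₂ := some m₀) (by simpa using hne) hm hm₀ hvert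
    obtain rfl := hm.unique hm₀
    have hne : ∀ g : HalfEdge N, org T g = org T h + (K h : ℝ) • vec T h → some g.1 ≠ some m := by
      rintro g hg hgm
      rw [Option.some_inj] at hgm
      rw [← hg, ← hgm] at hm
      exact hm.ne_point _ rfl
    have hnorm : ‖vec T h‖ = ‖vec T h₀‖ := by
      rw [vec, vec, norm_edgeVec, norm_edgeVec, hT.side_eq, hT.side_eq, hx, hx₀]
    have hv : vec T h = vec T h₀ := by
      have hn0 : 0 < ‖vec T h₀‖ := norm_pos_iff.2 (vec_ne_zero T h₀)
      rcases sameDir_or_neg_of_linear_eq_zero (vec_ne_zero T h) (vec_ne_zero T h₀) hl hl₀ with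
        ⟨c, hc0, h1⟩ | ⟨c, hc0, h1⟩
      · rw [h1, norm_smul, Real.norm_of_nonneg hc0.le] at hnorm
        have : c = 1 := by
          have : (c - 1) * ‖vec T h₀‖ = 0 := by linarith
          rcases mul_eq_zero.1 this with h6 | h6 <;> linarith
        rw [h1, this, one_smul]
      · exfalso
        -- The last edge of the second run would leave the common end in the direction of `vec T h`.
        have h2 : SameDir (vec T g₃) (vec T h) := by
          rw [hv₃]
          refine ⟨c, hc0, ?_⟩
          rw [smul_neg, ← h1, neg_neg]
        have h3 : g₂ = g₃ := hT.eq_of_germ (o := some m) (germ_of_onEdge hm hl) hg₂ hg₃ hv₂ h2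
          (hne _ hg₂) (hne _ hg₃)
        rw [h3] at hx₂
        exact hx₂ (by rw [hx₃, hx₀, hx])
    have hKK : K h = K h₀ := le_antisymm
      (hT.run_length_le (hx₀ ▸ hfree) hu₀ hu hv.symm hc hW.symm (hx₀.trans hx.symm))
      (hT.run_length_le (hx ▸ hfree) hu hu₀ hv hc₀ hW (hx.trans hx₀.symm))
    have hP : org T h = org T h₀ := by
      rw [hKK, hv] at hW
      exact add_right_cancel hW
    have hd : SameDir (vec T h) (vec T h₀) := by rw [hv]; exact .refl _
    by_cases h1 : h.1 = h₀.1
    · exact eq_of_sameDir h1 hP hd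
    · obtain ⟨h', hp, hne'⟩ := hu
      have : h' = h₀ := hT.partner_unique hp ⟨h1, hP, hd⟩
      exact absurd (by rw [this, hx₀, hx]) hne'

/-! ### Free sides, and the angles at the vertices -/

lemma commensurableSides_of_base {R : Tri} {L : ℝ} (hL : L ≠ 0)
    (h : ∀ k, ∃ ρ : ℚ, side R k = ρ * L) : CommensurableSides R := by
  intro i j
  obtain ⟨ρ, h1⟩ := h i
  obtain ⟨ρ', h2⟩ := h j
  refine ⟨ρ / ρ', ?_⟩
  rw [h1, h2, mul_div_mul_right _ _ hL]
  push_cast; rfl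

/-- A side that is not free is a rational combination, with nonnegative coefficients, of the
others. -/
lemma exists_rat_of_not_free {R : Tri} {x : Fin 3} (h : ¬ Free R x) : ∃ q r : ℚ, 0 ≤ q ∧ 0 ≤ r ∧
    side R x = q * side R (x + 1) + r * side R (x + 2) := by
  unfold Free at h
  push Not at h
  obtain ⟨K, c, h1, k, hk, hck⟩ := h
  have hsum : ∑ k, (c k : ℝ) * side R k =
      c x * side R x + (c (x + 1) * side R (x + 1) + c (x + 2) * side R (x + 2)) := by
    rw [Fin.sum_univ_three]
    fin_cases x <;> simp <;> ring
  rw [hsum] at h1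
  have p0 := side_pos R x
  have p1 := side_pos R (x + 1)
  have p2 := side_pos R (x + 2)
  have hpos : 0 < (c (x + 1) : ℝ) * side R (x + 1) + c (x + 2) * side R (x + 2) := by
    have hk' : k = x + 1 ∨ k = x + 2 := by
      fin_cases x <;> fin_cases k <;> simp_all
    have hck' : (0 : ℝ) < c k := by exact_mod_cast Nat.pos_of_ne_zero hck
    rcases hk' with rfl | rfl <;> positivity
  have hM : (0 : ℝ) < (K : ℝ) - c x := by
    by_contra hneg
    have : ((K : ℝ) - c x) * side R x ≤ 0 :=
      mul_nonpos_of_nonpos_of_nonneg (not_lt.1 hneg) p0.le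
    linarith
  have hMq : (0 : ℚ) < (K : ℚ) - c x := by exact_mod_cast hM
  refine ⟨c (x + 1) / (K - c x), c (x + 2) / (K - c x), by positivity, by positivity, ?_⟩
  push_cast
  field_simp
  linarith

/-- If the sides are not commensurable, then one of them is free. Otherwise each side would be a
rational combination of the others with nonnegative coefficients; because of the signs, these three
linear relations cannot all be proportional, so that they determine the ratios of the sides. -/
lemma exists_free {R : Tri} (h : ¬ CommensurableSides R) : ∃ x, Free R x := by
  by_contra! hno
  obtain ⟨q, r, hq, hr, ha⟩ := exists_rat_of_not_free (hno 0)
  obtain ⟨r', q', hr', hq', hb⟩ := exists_rat_of_not_free (hno 1)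
  obtain ⟨s, s', -, -, hc⟩ := exists_rat_of_not_free (hno 2)
  simp only [Fin.isValue, zero_add, Fin.reduceAdd] at ha hb hc
  have pa := side_pos R 0
  have pb := side_pos R 1
  have pc := side_pos R 2
  set a := side R 0
  set b := side R 1
  set c := side R 2
  apply h
  have hr0 : (0 : ℝ) ≤ r := by exact_mod_cast hr
  have hr0' : (0 : ℝ) ≤ r' := by exact_mod_cast hr'
  have hq0 : (0 : ℝ) ≤ q := by exact_mod_cast hq
  have hrel : (1 - q * q' : ℝ) * a = (q * r' + r) * c := by
    rw [hb] at ha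
    linear_combination ha
  rcases (by positivity : (0 : ℝ) ≤ q * r' + r).eq_or_lt with h0 | h0
  · have hr00 : (r : ℝ) = 0 := by nlinarith [mul_nonneg hq0 hr0']
    rw [hr00, zero_mul, add_zero] at ha
    refine commensurableSides_of_base pb.ne' fun k => ?_
    fin_cases k
    · exact ⟨q, ha⟩
    · exact ⟨1, by simp [b]⟩
    · refine ⟨s * q + s', ?_⟩
      push_cast
      change c = _
      rw [ha] at hc
      linear_combination hc
  · have hD : (1 - q * q' : ℝ) ≠ 0 := by
      intro h1
      rw [h1, zero_mul] at hrel
      have := mul_pos h0 pc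
      linarith
    have ha' : a = ((q * r' + r) / (1 - q * q') : ℝ) * c := by
      field_simp
      linear_combination hrel
    refine commensurableSides_of_base pc.ne' fun k => ?_
    fin_cases k
    · refine ⟨(q * r' + r) / (1 - q * q'), ?_⟩
      push_cast
      exact ha'
    · refine ⟨r' + q' * ((q * r' + r) / (1 - q * q')), ?_⟩
      push_cast
      change b = _
      rw [ha'] at hb
      linear_combination hb
    · exact ⟨1, by simp [c]⟩

/-- The angle at the first vertex of the tile is an irrational multiple of `π`, and the third one
is `2π/3`. -/
structure IsIrrationalTile (R : Tri) : Prop where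
  irrational : ∀ q : ℚ, vertexAngle R 0 ≠ q * Real.pi
  gamma : vertexAngle R 2 = 2 * Real.pi / 3

lemma isIrrationalTile {R : Tri} (hγ : vertexAngle R 2 = 2 * Real.pi / 3)
    (hR : ¬ CommensurableAngles R) : IsIrrationalTile R := by
  refine ⟨fun q hq => hR fun i => ?_, hγ⟩
  have hs := vertexAngle_sum R
  fin_cases i
  · exact ⟨q, hq⟩
  · refine ⟨1 / 3 - q, ?_⟩
    push_cast
    rw [hq, hγ] at hs
    linear_combination hs
  · refine ⟨2 / 3, ?_⟩
    push_cast
    rw [hγ]; ring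

/-- The only relations between the angles of the tile and a straight angle. -/
lemma IsIrrationalTile.counts (hR : IsIrrationalTile R) {c : Fin 3 → ℕ} {m : ℕ}
    (h : ∑ i, (c i : ℝ) * vertexAngle R i = m * Real.pi) :
    c 0 = c 1 ∧ c 0 + 2 * c 2 = 3 * m := by
  have hs := vertexAngle_sum R
  rw [hR.gamma] at hs
  rw [Fin.sum_univ_three, hR.gamma] at h
  have hb : vertexAngle R 1 = Real.pi / 3 - vertexAngle R 0 := by linarith
  rw [hb] at h
  have h1 : ((c 0 : ℝ) - c 1) * vertexAngle R 0 =
      (m - c 1 / 3 - 2 * c 2 / 3) * Real.pi := by linear_combination h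
  have h2 : c 0 = c 1 := by
    by_contra hne
    have hne' : ((c 0 : ℝ) - c 1) ≠ 0 := sub_ne_zero.2 (by exact_mod_cast hne)
    apply hR.irrational ((m - c 1 / 3 - 2 * c 2 / 3) / (c 0 - c 1))
    push_cast
    field_simp
    linear_combination 3 * h1
  refine ⟨h2, ?_⟩
  rw [h2, sub_self, zero_mul] at h1
  have h3 : (m - c 1 / 3 - 2 * c 2 / 3 : ℝ) = 0 := by
    rcases mul_eq_zero.1 h1.symm with h3 | h3
    · exact h3
    · exact absurd h3 Real.pi_ne_zero
  have h4 : (c 1 : ℝ) + 2 * c 2 = 3 * m := by linarith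
  rw [h2]
  exact_mod_cast h4

lemma IsTiling.counts_flat (hT : IsTiling ABC R T) (hR : IsIrrationalTile R) {P : Plane}
    (hP : IsVertex T P) {o : Option (Fin N)} {k : Fin 3} (h : OnEdge (cell ABC T o) k P) :
    cnt T 0 P = cnt T 1 P ∧ cnt T 0 P + 2 * cnt T 2 P = 3 := by
  have := hT.angle_sum_flat hP h
  exact hR.counts (c := fun i => cnt T i P) (m := 1) (by simpa using this)

lemma IsTiling.counts_inner (hT : IsTiling ABC R T) (hR : IsIrrationalTile R) {P : Plane}
    (hP : IsVertex T P) (h : ∀ o k, ¬ OnEdge (cell ABC T o) k P) (h' : ∀ j, P ≠ ABC.points j) :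
    cnt T 0 P = cnt T 1 P ∧ cnt T 0 P + 2 * cnt T 2 P = 6 := by
  have := hT.angle_sum_inner hP h h'
  exact hR.counts (c := fun i => cnt T i P) (m := 2) (by simpa using this)

lemma IsTiling.counts_corners (hT : IsTiling ABC R T) (hR : IsIrrationalTile R) :
    ∑ j, cnt T 0 (ABC.points j) = ∑ j, cnt T 1 (ABC.points j) ∧
      ∑ j, cnt T 0 (ABC.points j) + 2 * ∑ j, cnt T 2 (ABC.points j) = 3 := by
  refine hR.counts (c := fun i => ∑ j, cnt T i (ABC.points j)) (m := 1) ?_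
  have h : ∑ j, ∑ i, (cnt T i (ABC.points j) : ℝ) * vertexAngle R i = Real.pi := by
    rw [Fin.sum_univ_three]
    simp only [hT.angle_sum_corner]
    exact vertexAngle_sum ABC
  rw [Finset.sum_comm] at h
  push_cast
  simp only [Finset.sum_mul]
  rw [h, one_mul]

lemma angle_eq_vertexAngle (t : Tri) {i j k : Fin 3} (hij : i ≠ j) (hjk : j ≠ k) (hik : i ≠ k) :
    ∠ (t.points i) (t.points j) (t.points k) = vertexAngle t j := by
  unfold vertexAngle
  have : (i = j + 1 ∧ k = j + 2) ∨ (i = j + 2 ∧ k = j + 1) := by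
    fin_cases i <;> fin_cases j <;> fin_cases k <;> simp_all
  rcases this with ⟨rfl, rfl⟩ | ⟨rfl, rfl⟩
  · rfl
  · rw [angle_comm]

lemma not_collinear_points (t : Tri) {i j k : Fin 3} (hij : i ≠ j) (hjk : j ≠ k) (hik : i ≠ k) :
    ¬ Collinear ℝ {t.points i, t.points j, t.points k} := by
  intro h
  have h1 := (collinear_iff_eq_or_eq_or_angle_eq_zero_or_angle_eq_pi).1 h
  rw [angle_eq_vertexAngle t hij hjk hik] at h1
  rcases h1 with h1 | h1 | h1 | h1
  · exact points_ne t hij h1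
  · exact points_ne t hjk.symm h1
  · exact (vertexAngle_pos t j).ne' h1
  · exact (vertexAngle_lt_pi t j).ne h1

lemma isSimilarTo_of_angles {s t : Tri} (σ : Equiv.Perm (Fin 3))
    (h : ∀ i, vertexAngle s (σ i) = vertexAngle t i) : IsSimilarTo s t := by
  refine ⟨σ, ?_⟩
  have hσ : ∀ i j, i ≠ j → σ i ≠ σ j := fun i j hij => σ.injective.ne hij
  have hcol := not_collinear_points s (hσ 0 1 (by decide)) (hσ 1 2 (by decide))
    (hσ 0 2 (by decide))
  have := similar_of_angle_angle (a' := t.points 0) (b' := t.points 1) (c' := t.points 2) hcol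
    (by rw [angle_eq_vertexAngle s (hσ 0 1 (by decide)) (hσ 1 2 (by decide)) (hσ 0 2 (by decide)),
          angle_eq_vertexAngle t (by decide) (by decide) (by decide), h])
    (by rw [angle_eq_vertexAngle s (hσ 1 2 (by decide)) (hσ 2 0 (by decide)) (hσ 1 0 (by decide)),
          angle_eq_vertexAngle t (by decide) (by decide) (by decide), h])
  have e1 : s.points ∘ σ = ![s.points (σ 0), s.points (σ 1), s.points (σ 2)] := by
    funext i; fin_cases i <;> rfl
  have e2 : t.points = ![t.points 0, t.points 1, t.points 2] := by
    funext i; fin_cases i <;> rfl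
  rw [e1, e2]
  exact this

lemma IsTiling.sum_cnt_corner_pos (hT : IsTiling ABC R T) (j : Fin 3) :
    0 < ∑ i, cnt T i (ABC.points j) := by
  rw [Finset.sum_pos_iff]
  by_contra! hno
  have h := hT.angle_sum_corner j
  rw [Finset.sum_eq_zero fun i hi => by
    rw [Nat.le_zero.1 (hno i hi), Nat.cast_zero, zero_mul]] at h
  exact (vertexAngle_pos ABC j).ne h

/-- The corners of a tiled triangle that is not similar to the tile contain three angles of each
of the first two kinds, and none of the third. -/
lemma IsTiling.corners_of_not_similar (hT : IsTiling ABC R T) (hR : IsIrrationalTile R)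
    (hsim : ¬ IsSimilarTo ABC R) :
    ∑ j, cnt T 0 (ABC.points j) = 3 ∧ ∑ j, cnt T 1 (ABC.points j) = 3 ∧
      ∀ j, cnt T 2 (ABC.points j) = 0 := by
  obtain ⟨h1, h2⟩ := hT.counts_corners hR
  rcases Nat.eq_zero_or_pos (∑ j, cnt T 2 (ABC.points j)) with h0 | h0
  · refine ⟨by omega, by omega, fun j => ?_⟩
    exact (Finset.sum_eq_zero_iff.1 h0) j (Finset.mem_univ j)
  · exfalso
    have hone : ∀ i, ∑ j, cnt T i (ABC.points j) = 1 := by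
      intro i
      fin_cases i
      · change ∑ j, cnt T 0 (ABC.points j) = 1; omega
      · change ∑ j, cnt T 1 (ABC.points j) = 1; omega
      · change ∑ j, cnt T 2 (ABC.points j) = 1; omega
    have hex : ∀ i, ∃ j, ∀ j', cnt T i (ABC.points j') = if j' = j then 1 else 0 := by
      intro i
      obtain ⟨j, -, hj⟩ := Finset.exists_ne_zero_of_sum_ne_zero
        (by rw [hone i]; exact one_ne_zero)
      have h4 := hone i
      rw [← Finset.add_sum_erase _ _ (Finset.mem_univ j)] at h4
      refine ⟨j, fun j' => ?_⟩
      split_ifs with h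
      · subst h; omega
      · have h5 : ∑ x ∈ Finset.univ.erase j, cnt T i (ABC.points x) = 0 := by omega
        exact (Finset.sum_eq_zero_iff.1 h5) j' (by simp [h])
    choose f hf using hex
    have hsurj : Function.Surjective f := by
      intro j
      obtain ⟨i, -, hi⟩ := Finset.exists_ne_zero_of_sum_ne_zero (hT.sum_cnt_corner_pos j).ne'
      rw [hf] at hi
      exact ⟨i, by by_contra hne; exact hi (if_neg (Ne.symm hne))⟩
    have hbij := Finite.injective_iff_bijective.1 (Finite.injective_iff_surjective.2 hsurj)
    refine hsim (isSimilarTo_of_angles (Equiv.ofBijective f hbij) fun i => ?_)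
    rw [Equiv.ofBijective_apply, ← hT.angle_sum_corner, Finset.sum_eq_single i]
    · simp [hf]
    · intro i' _ hi'
      simp [hf, hbij.1.ne hi'.symm]
    · simp

/-! ### A free side of the tile adjacent to the angle `2π/3` -/

lemma sum_cnt_vertices (T : Fin N → Tri) (i : Fin 3) : ∑ P ∈ vertices T, cnt T i P = N := by
  classical
  have h := Finset.card_eq_sum_card_fiberwise (s := (Finset.univ : Finset (Fin N)))
    (f := fun n => (T n).points i) (t := vertices T)
    (fun n _ => Finset.mem_coe.2 (mem_vertices.2 ⟨n, i, rfl⟩))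
  rw [Finset.card_univ, Fintype.card_fin] at h
  conv_rhs => rw [h]
  refine Finset.sum_congr rfl fun P _ => ?_
  unfold cnt
  congr 1
  ext n
  simp [eq_comm]

lemma IsSwitch.exists_onEdge {x : Fin 3} {P : Plane} (h : IsSwitch T x P) :
    ∃ m k, OnEdge (T m) k P := by
  obtain ⟨m, k, -, -, h, -⟩ := h
  exact ⟨m, k, h⟩

lemma IsTiling.exists_unmatched_of_isSwitch (hT : IsTiling ABC R T) {x : Fin 3} {P : Plane}
    (h : IsSwitch T x P) (hev : Even (cnt T (x + 1) P + cnt T (x + 2) P)) :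
    ∃ h ∈ unmatched T x, org T h = P := by
  obtain ⟨m, k, h₁, h₂, hm, hl, ho₁, ho₂, hd, hx₁, hx₂⟩ := h
  obtain ⟨h, h1, h2, h3⟩ := hT.exists_unmatched_of_switch (o := some m) hm ho₁ ho₂ hl hd hx₁ hx₂ hev
  exact ⟨h, by simp [unmatched, h1, h3], h2⟩

/-- Neither of the sides `a` and `b` is free. At an inner vertex where three angles `2π/3` meet
there is an unmatched half-edge, as there is at every switch where an angle `2π/3` occurs. Hence
there are at most as many vertices of the former kind as switches without an angle `2π/3`; but the
tiles have as many angles `2π/3` as angles `α`, and in the corners of `ABC` the latter are in the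
majority. -/
lemma IsTiling.not_free (hT : IsTiling ABC R T) (hR : IsIrrationalTile R)
    (hsim : ¬ IsSimilarTo ABC R) {x : Fin 3} (hx : x ≠ 2) : ¬ Free R x := by
  classical
  intro hfree
  obtain ⟨hc0, hc1, hc2⟩ := hT.corners_of_not_similar hR hsim
  have hxsum : ∀ P, cnt T 0 P = cnt T 1 P →
      cnt T (x + 1) P + cnt T (x + 2) P = cnt T 0 P + cnt T 2 P := by
    intro P hP
    have : x = 0 ∨ x = 1 := by fin_cases x <;> simp_all
    rcases this with rfl | rfl
    · simp only [Fin.isValue, zero_add]; omega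
    · simp only [Fin.isValue, Fin.reduceAdd]; omega
  -- `St` are the inner vertices where three angles `2π/3` meet; `S₁` and `S₀` are the switches with
  -- one angle `2π/3` and with none.
  set St := (vertices T).filter fun P =>
    (∀ o k, ¬ OnEdge (cell ABC T o) k P) ∧ (∀ j, P ≠ ABC.points j) ∧ cnt T 2 P = 3 with hSt
  set S := switches T x with hS
  set S₁ := S.filter fun P => cnt T 2 P = 1 with hS₁
  set S₀ := S.filter fun P => ¬ cnt T 2 P = 1 with hS₀
  have hSflat : ∀ P ∈ S, IsVertex T P ∧ ∃ m k, OnEdge (T m) k P := fun P hP =>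
    ⟨mem_vertices.1 (Finset.mem_filter.1 hP).1, (Finset.mem_filter.1 hP).2.exists_onEdge⟩
  have hSt1 : ∀ P ∈ St, ∃ h ∈ unmatched T x, org T h = P := by
    intro P hP
    obtain ⟨hv, h1, h2, h3⟩ := Finset.mem_filter.1 hP
    have h4 := hT.counts_inner hR (mem_vertices.1 hv) h1 h2
    obtain ⟨h, h5, h6, h7⟩ := hT.exists_unmatched_of_odd (x := x) h1 h2 (by
      rw [hxsum P h4.1, show cnt T 0 P + cnt T 2 P = 3 by omega]; decide)
    exact ⟨h, by simp [unmatched, h5, h7], h6⟩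
  have hS₁1 : ∀ P ∈ S₁, ∃ h ∈ unmatched T x, org T h = P := by
    intro P hP
    obtain ⟨hPS, h1⟩ := Finset.mem_filter.1 hP
    obtain ⟨hv, m, k, hm⟩ := hSflat P hPS
    have h2 := hT.counts_flat hR (o := some m) hv hm
    refine hT.exists_unmatched_of_isSwitch (Finset.mem_filter.1 hPS).2 ?_
    rw [hxsum P h2.1, show cnt T 0 P + cnt T 2 P = 2 by omega]
    decide
  have hdisj : Disjoint St S₁ := by
    rw [Finset.disjoint_left]
    intro P h1 h2
    have h3 := (Finset.mem_filter.1 h1).2.2.2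
    have h4 := (Finset.mem_filter.1 h2).2
    omega
  have hle : St.card + S₁.card ≤ S.card := by
    rw [← Finset.card_union_of_disjoint hdisj]
    refine le_trans ?_ (hT.card_unmatched_le hfree)
    refine le_trans (Finset.card_le_card ?_) (Finset.card_image_le (f := org T))
    intro P hP
    rw [Finset.mem_image]
    rcases Finset.mem_union.1 hP with h | h
    · exact hSt1 P h
    · exact hS₁1 P h
  have hsplit : S₁.card + S₀.card = S.card := Finset.card_filter_add_card_filter_not _
  -- The surplus of angles `α` over angles `2π/3`, summed over all vertices, is zero.
  have htotal : ∑ P ∈ vertices T, ((cnt T 0 P : ℤ) - cnt T 2 P) = 0 := by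
    rw [Finset.sum_sub_distrib, ← Nat.cast_sum, ← Nat.cast_sum, sum_cnt_vertices,
      sum_cnt_vertices, sub_self]
  set C : Finset Plane := Finset.univ.image ABC.points with hC
  have hCsub : C ⊆ vertices T := by
    intro P hP
    obtain ⟨j, -, rfl⟩ := Finset.mem_image.1 hP
    exact mem_vertices.2 (hT.isVertex_corner j)
  have hCsum : ∑ P ∈ C, ((cnt T 0 P : ℤ) - cnt T 2 P) = 3 := by
    rw [hC, Finset.sum_image fun i _ j _ h => ABC.independent.injective h]
    simp only [hc2, Nat.cast_zero, sub_zero]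
    exact_mod_cast hc0
  have hbound : ∀ P ∈ vertices T \ C,
      (if P ∈ S₀ then (3 : ℤ) else 0) - (if P ∈ St then (3 : ℤ) else 0) ≤
        (cnt T 0 P : ℤ) - cnt T 2 P := by
    intro P hP
    obtain ⟨hPv, hPC⟩ := Finset.mem_sdiff.1 hP
    have hv := mem_vertices.1 hPv
    have hcorner : ∀ j, P ≠ ABC.points j := by
      rintro j rfl
      exact hPC (Finset.mem_image_of_mem _ (Finset.mem_univ j))
    by_cases hflat : ∃ o k, OnEdge (cell ABC T o) k P
    · obtain ⟨o, k, hk⟩ := hflat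
      have h1 := hT.counts_flat hR hv hk
      have h2 : P ∉ St := fun h => (Finset.mem_filter.1 h).2.1 o k hk
      rw [if_neg h2]
      split_ifs with h3
      · have h4 := (Finset.mem_filter.1 h3).2
        omega
      · omega
    · push Not at hflat
      have h1 := hT.counts_inner hR hv hflat hcorner
      have h2 : P ∉ S₀ := by
        intro h
        obtain ⟨-, m, k, hm⟩ := hSflat P (Finset.mem_filter.1 h).1
        exact hflat (some m) k hm
      rw [if_neg h2]
      split_ifs with h3
      · have h4 := (Finset.mem_filter.1 h3).2.2.2
        omega
      · have h4 : cnt T 2 P ≠ 3 := fun h => h3 (Finset.mem_filter.2 ⟨hPv, hflat, hcorner, h⟩)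
        omega
  have hsum := Finset.sum_le_sum hbound
  have hdiff := Finset.sum_sdiff (f := fun P => ((cnt T 0 P : ℤ) - cnt T 2 P)) hCsub
  rw [htotal, hCsum] at hdiff
  rw [Finset.sum_sub_distrib, ← Finset.sum_filter, ← Finset.sum_filter, Finset.sum_const,
    Finset.sum_const] at hsum
  have hS₀C : (vertices T \ C).filter (fun P => P ∈ S₀) = S₀ := by
    ext P
    simp only [Finset.mem_filter, Finset.mem_sdiff]
    refine ⟨fun h => h.2, fun h => ⟨⟨?_, ?_⟩, h⟩⟩
    · exact (Finset.mem_filter.1 (Finset.mem_filter.1 h).1).1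
    · intro hPC
      obtain ⟨j, -, rfl⟩ := Finset.mem_image.1 hPC
      obtain ⟨-, m, k, hm⟩ := hSflat _ (Finset.mem_filter.1 h).1
      exact hT.not_corner_of_onEdge hm rfl
  have hStC : ((vertices T \ C).filter (fun P => P ∈ St)).card ≤ St.card :=
    Finset.card_le_card fun P hP => (Finset.mem_filter.1 hP).2
  rw [hS₀C] at hsum
  simp only [nsmul_eq_mul] at hsum
  have : (((vertices T \ C).filter (fun P => P ∈ St)).card : ℤ) ≤ St.card := by exact_mod_cast hStC
  omega

/-! ### A free side opposite the angle `2π/3` -/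

/-- If the side `c` is free, then half-edges of type `c` are unmatched only at relative interior
points of edges of tiles. -/
lemma IsTiling.exists_onEdge_of_unmatched (hT : IsTiling ABC R T) (hR : IsIrrationalTile R)
    (hfree : Free R 2) {h : HalfEdge N} (hh : h ∈ unmatched T 2) :
    ∃ m k, OnEdge (T m) k (org T h) := by
  classical
  have hsub : switches T 2 ⊆ (unmatched T 2).image (org T) := by
    intro P hP
    obtain ⟨hv, hs⟩ := Finset.mem_filter.1 hP
    obtain ⟨m, k, hm⟩ := hs.exists_onEdge
    have h1 := hT.counts_flat hR (o := some m) (mem_vertices.1 hv) hm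
    have h2 : Even (cnt T (2 + 1) P + cnt T (2 + 2) P) := by
      simp only [Fin.isValue, Fin.reduceAdd]
      rw [h1.1]; exact Even.add_self _
    exact Finset.mem_image.2 (hT.exists_unmatched_of_isSwitch hs h2)
  have heq := Finset.eq_of_subset_of_card_le hsub
    (Finset.card_image_le.trans (hT.card_unmatched_le hfree))
  have hmem : org T h ∈ switches T 2 := heq ▸ Finset.mem_image_of_mem _ hh
  exact (Finset.mem_filter.1 hmem).2.exists_onEdge

lemma IsTiling.onEdge_side (hT : IsTiling ABC R T) {P : Plane} (hP : IsVertex T P) {j : Fin 3}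
    (h : coord ABC j P = 0) (h' : ∀ i, P ≠ ABC.points i) : OnEdge ABC j P := by
  have hmem : P ∈ ABC.closedInterior := by
    obtain ⟨n, i, rfl⟩ := hP
    exact hT.subset n ((T n).point_mem_closedInterior i)
  rcases cases_of_mem_closedInterior hmem with hi | ⟨k, hk⟩ | ⟨i, hi⟩
  · rw [mem_interior_iff] at hi
    exact absurd h (hi j).ne'
  · have : k = j := by
      by_contra hne
      have hjk : j = k + 1 ∨ j = k + 2 := by
        fin_cases j <;> fin_cases k <;> simp_all
      rcases hjk with rfl | rfl
      · exact hk.2.1.ne' h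
      · exact hk.2.2.ne' h
    exact this ▸ hk
  · exact absurd hi (h' i)

/-- The half-edge with the opposite direction. -/
def rev (h : HalfEdge N) : HalfEdge N := (h.1, h.2.1, !h.2.2)

lemma org_rev (T : Fin N → Tri) (h : HalfEdge N) : org T (rev h) = org T h + vec T h := by
  simp [rev, org, vec, edgeVec]

lemma vec_rev (T : Fin N → Tri) (h : HalfEdge N) : vec T (rev h) = -vec T h := edgeVec_not _ _ _

/-- Half-edges of one tile beginning at its third vertex do not point in
opposite directions. -/
lemma not_sameDir_neg {t : Tri} {k k' : Fin 3} {s s' : Bool}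
    (hs : startIdx k s = 2) (hs' : startIdx k' s' = 2) :
    ¬ SameDir (edgeVec t k' s') (-edgeVec t k s) := by
  rintro ⟨c, hc, h⟩
  obtain ⟨e0, e1, e2⟩ := linear_edgeVec t k s
  obtain ⟨e0', e1', e2'⟩ := linear_edgeVec t k' s'
  have h1 := congrArg (coord t 2).linear h
  rw [map_neg, map_smul, ← hs, e1, hs, ← hs', e1'] at h1
  simp only [smul_eq_mul] at h1
  linarith

lemma startIdx_not_eq_two {k : Fin 3} {s : Bool} (hk : k ≠ 2) (hs : startIdx k s ≠ 2) :
    startIdx k (!s) = 2 := by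
  revert k s
  decide

/-- If the side `c` is free, then all edges along the sides of `ABC` are of type `c`. An edge along
a side that is of another type has the angle `2π/3` at one end; since no change of type occurs
there and since this angle occurs only once, the next edge has the same property. This cannot go
on until a corner. -/
lemma IsTiling.boundary_type (hT : IsTiling ABC R T) (hR : IsIrrationalTile R)
    (hsim : ¬ IsSimilarTo ABC R) (hfree : Free R 2) {h : HalfEdge N} {j : Fin 3}
    (ho : coord ABC j (org T h) = 0) (hl : (coord ABC j).linear (vec T h) = 0) : h.2.1 = 2 := by
  classical
  obtain ⟨-, -, hc2⟩ := hT.corners_of_not_similar hR hsim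
  have key : ∀ i, ¬ ∃ h : HalfEdge N, coord ABC j (org T h) = 0 ∧
      (coord ABC j).linear (vec T h) = 0 ∧ h.2.1 ≠ 2 ∧ startIdx h.2.1 (!h.2.2) = 2 ∧
      0 < (coord ABC i).linear (vec T h) := by
    intro i hex
    set B : Finset (HalfEdge N) := Finset.univ.filter fun h : HalfEdge N =>
      coord ABC j (org T h) = 0 ∧ (coord ABC j).linear (vec T h) = 0 ∧ h.2.1 ≠ 2 ∧
        startIdx h.2.1 (!h.2.2) = 2 ∧ 0 < (coord ABC i).linear (vec T h) with hB
    have hBne : B.Nonempty := by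
      obtain ⟨h, hh⟩ := hex
      exact ⟨h, by simpa [hB] using hh⟩
    obtain ⟨h, hhB, hmax⟩ := B.exists_max_image (fun h => coord ABC i (org T (rev h))) hBne
    obtain ⟨-, ho, hl, hk, hs, hpos⟩ := Finset.mem_filter.1 hhB
    set W := org T (rev h) with hW
    have hWeq : W = (T h.1).points 2 := by
      rw [hW, ← hs]; rfl
    have hWv : IsVertex T W := isVertex_org T _
    have hWj : coord ABC j W = 0 := by
      rw [hW, org_rev]
      have := coord_add_smul ABC j (org T h) (vec T h) 1
      rwa [one_smul, ho, hl, mul_zero, add_zero] at this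
    have hcorner : ∀ i, W ≠ ABC.points i := by
      intro i' hi'
      have h1 := hc2 i'
      rw [← hi', cnt, Finset.card_eq_zero, Finset.filter_eq_empty_iff] at h1
      exact h1 (Finset.mem_univ h.1) hWeq
    have hWe : OnEdge (cell ABC T none) j W := hT.onEdge_side hWv hWj hcorner
    have hcounts := hT.counts_flat hR hWv hWe
    obtain ⟨g, -, hgW, hgd⟩ := hT.exists_halfEdge_flat hWv hWe (vec_ne_zero T h) hl
    have hgl : (coord ABC j).linear (vec T g) = 0 := hgd.symm.linear_eq_zero hl
    have hgd' : SameDir (vec T g) (-vec T (rev h)) := by rwa [vec_rev, neg_neg]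
    have hg2 : g.2.1 ≠ 2 := by
      intro hg2
      have hd : SameDir (vec T (rev h)) (-vec T g) := by
        obtain ⟨c, hc, h1⟩ := hgd.symm
        rw [vec_rev, h1]
        exact ⟨c, hc, by rw [smul_neg]⟩
      have hev : Even (cnt T (2 + 1) W + cnt T (2 + 2) W) := by
        simp only [Fin.isValue, Fin.reduceAdd]
        rw [hcounts.1]; exact Even.add_self _
      obtain ⟨u, hu1, hu2, hu3⟩ := hT.exists_unmatched_of_switch (x := 2) hWe hgW rfl hgl hd
        hg2 hk hev
      obtain ⟨m, k, hm⟩ := hT.exists_onEdge_of_unmatched hR hfree (h := u)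
        (by simp [unmatched, hu1, hu3])
      rw [hu2] at hm
      exact hT.not_isVertex (o₁ := none) (o₂ := some m) (by simp) hWe hm hWv
    have hgs : startIdx g.2.1 g.2.2 ≠ 2 := by
      intro hgs
      have hgn : g.1 ≠ h.1 := by
        intro hgn
        refine not_sameDir_neg (t := T h.1) (k := h.2.1) (s := !h.2.2) (k' := g.2.1)
          (s' := g.2.2) hs hgs ?_
        have h1 : vec T g = edgeVec (T h.1) g.2.1 g.2.2 := by rw [vec, hgn]
        rw [← h1]
        exact hgd'
      have h1 : 1 < cnt T 2 W := by
        rw [cnt, Finset.one_lt_card]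
        refine ⟨h.1, by simpa using hWeq, g.1, ?_, hgn.symm⟩
        rw [Finset.mem_filter]
        refine ⟨Finset.mem_univ _, ?_⟩
        rw [← hgW, org, hgs]
      omega
    have hgs' : startIdx g.2.1 (!g.2.2) = 2 := startIdx_not_eq_two hg2 hgs
    have hgpos : 0 < (coord ABC i).linear (vec T g) := by
      obtain ⟨c, hc, h1⟩ := hgd.symm
      rw [h1, map_smul, smul_eq_mul]
      positivity
    have hgB : g ∈ B := Finset.mem_filter.2 ⟨Finset.mem_univ _, hgW ▸ hWj, hgl, hg2, hgs', hgpos⟩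
    have h1 := hmax g hgB
    have h2 := coord_add_smul ABC i W (vec T g) 1
    rw [one_smul, one_mul, ← hgW, ← org_rev, hgW] at h2
    linarith
  by_contra hne
  -- Orient the edge towards its end with the angle `2π/3`.
  have horient : ∃ h' : HalfEdge N, coord ABC j (org T h') = 0 ∧
      (coord ABC j).linear (vec T h') = 0 ∧ h'.2.1 ≠ 2 ∧ startIdx h'.2.1 (!h'.2.2) = 2 := by
    by_cases hs : startIdx h.2.1 (!h.2.2) = 2
    · exact ⟨h, ho, hl, hne, hs⟩
    · refine ⟨rev h, ?_, by rw [vec_rev, map_neg, hl, neg_zero], hne, ?_⟩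
      · have := coord_add_smul ABC j (org T h) (vec T h) 1
        rwa [one_smul, ho, hl, mul_zero, add_zero, ← org_rev] at this
      · exact startIdx_not_eq_two (s := !h.2.2) hne hs
  obtain ⟨h', h1, h2, h3, h4⟩ := horient
  have h5 := eq_smul_edgeVec ABC j true h2
  obtain ⟨-, e1, e2⟩ := linear_edgeVec ABC j true
  have h7 : (coord ABC (startIdx j true)).linear (vec T h') =
      -(coord ABC (startIdx j (!true))).linear (vec T h') := by
    conv_lhs => rw [h5]
    rw [map_smul, e1, smul_eq_mul, mul_neg_one]
  rcases lt_trichotomy ((coord ABC (startIdx j (!true))).linear (vec T h')) 0 with h8 | h8 | h8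
  · exact key _ ⟨h', h1, h2, h3, h4, by rw [h7]; linarith⟩
  · rw [h8, zero_smul] at h5
    exact vec_ne_zero T h' h5
  · exact key _ ⟨h', h1, h2, h3, h4, h8⟩

lemma IsTiling.boundaryAllC (hT : IsTiling ABC R T) (hR : IsIrrationalTile R)
    (hsim : ¬ IsSimilarTo ABC R) (hfree : Free R 2) : BoundaryAllC ABC T := by
  rintro n j ⟨k, hk⟩
  have h := (edge_subset_iff _ _ _ _).1 hk
  rw [mem_edge_iff, mem_edge_iff] at h
  have h1 : ((n, k, true) : HalfEdge N).2.1 = 2 := by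
    refine hT.boundary_type hR hsim hfree (j := j) ?_ ?_
    · exact h.1.1
    · change (coord ABC j).linear ((T n).points (k + 2) - (T n).points (k + 1)) = 0
      rw [coord_linear_sub, h.1.1, h.2.1, sub_zero]
  simp only at h1
  rwa [h1] at hk

lemma equilateral_of_angles {t : Tri} (h : ∀ i, vertexAngle t i = Real.pi / 3) :
    t.Equilateral := by
  have hne : ∀ i, vertexAngle t i ≠ Real.pi := fun i => (vertexAngle_lt_pi t i).ne
  have key : ∀ i j k : Fin 3, i ≠ j → j ≠ k → i ≠ k →
      dist (t.points i) (t.points j) = dist (t.points i) (t.points k) := by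
    intro i j k hij hjk hik
    refine dist_eq_of_angle_eq_angle_of_angle_ne_pi ?_ ?_
    · rw [angle_eq_vertexAngle t hij hjk hik, angle_eq_vertexAngle t hik hjk.symm hij, h, h]
    · rw [angle_eq_vertexAngle t hij.symm hik hjk]; exact hne i
  refine ⟨dist (t.points 0) (t.points 1), ?_⟩
  have h1 := key 0 1 2 (by decide) (by decide) (by decide)
  have h2 := key 1 0 2 (by decide) (by decide) (by decide)
  intro i j hij
  have h3 := dist_comm (t.points 0) (t.points 1)
  have h4 := dist_comm (t.points 0) (t.points 2)
  have h5 := dist_comm (t.points 1) (t.points 2)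
  fin_cases i <;> fin_cases j <;> simp only [Fin.isValue, Fin.zero_eta, Fin.mk_one,
    Fin.reduceFinMk] <;> first | exact absurd rfl hij | linarith

/-- The shape of `ABC`: every corner contains two tiles. -/
lemma IsTiling.shape (hT : IsTiling ABC R T) (hR : IsIrrationalTile R)
    (hsim : ¬ IsSimilarTo ABC R) (hfree : Free R 2) :
    ABC.Equilateral ∨
      HasAngles ABC (Real.pi / 3) (2 * vertexAngle R 0) (2 * vertexAngle R 1) := by
  obtain ⟨hc0, hc1, hc2⟩ := hT.corners_of_not_similar hR hsim
  have heven : ∀ j, Even (cnt T 0 (ABC.points j) + cnt T 1 (ABC.points j)) := by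
    intro j
    refine hT.even_corner (x := 2) ?_ ?_
    · intro h h1 h2 h3
      obtain ⟨m, k, hm⟩ := hT.exists_onEdge_of_unmatched hR hfree (h := h)
        (by simp [unmatched, h1, h3])
      exact hT.not_corner_of_onEdge hm h2
    · rintro h k s hks h1 ⟨c, hc, h2⟩
      refine hT.boundary_type hR hsim hfree (j := k) ?_ ?_
      · rw [h1, ← hks]
        exact coord_of_ne _ (startIdx_ne k s).symm
      · have h3 := (linear_edgeVec ABC k s).1
        rw [h2, map_smul, smul_eq_mul] at h3
        exact (mul_eq_zero.1 h3).resolve_left hc.ne'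
  have htwo : ∀ j, cnt T 0 (ABC.points j) + cnt T 1 (ABC.points j) = 2 := by
    have hge : ∀ j, 2 ≤ cnt T 0 (ABC.points j) + cnt T 1 (ABC.points j) := by
      intro j
      have h1 := hT.sum_cnt_corner_pos j
      rw [Fin.sum_univ_three, hc2] at h1
      obtain ⟨r, hr⟩ := heven j
      omega
    rw [Fin.sum_univ_three] at hc0 hc1
    have h0 := hge 0
    have h1 := hge 1
    have h2 := hge 2
    intro j
    fin_cases j
    · change cnt T 0 (ABC.points 0) + cnt T 1 (ABC.points 0) = 2; omega
    · change cnt T 0 (ABC.points 1) + cnt T 1 (ABC.points 1) = 2; omega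
    · change cnt T 0 (ABC.points 2) + cnt T 1 (ABC.points 2) = 2; omega
  have hs := vertexAngle_sum R
  rw [hR.gamma] at hs
  have hangle : ∀ j, vertexAngle ABC j = cnt T 0 (ABC.points j) * vertexAngle R 0 +
      cnt T 1 (ABC.points j) * vertexAngle R 1 := by
    intro j
    rw [← hT.angle_sum_corner, Fin.sum_univ_three, hc2, Nat.cast_zero, zero_mul, add_zero]
  have hone : ∀ j, cnt T 0 (ABC.points j) = 1 → vertexAngle ABC j = Real.pi / 3 := by
    intro j h
    have h1 : cnt T 1 (ABC.points j) = 1 := by have := htwo j; omega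
    rw [hangle, h, h1]; push_cast; linarith
  have htwo' : ∀ j, cnt T 0 (ABC.points j) = 2 → vertexAngle ABC j = 2 * vertexAngle R 0 := by
    intro j h
    have h1 : cnt T 1 (ABC.points j) = 0 := by have := htwo j; omega
    rw [hangle, h, h1]; push_cast; ring
  have hzero : ∀ j, cnt T 0 (ABC.points j) = 0 → vertexAngle ABC j = 2 * vertexAngle R 1 := by
    intro j h
    have h1 : cnt T 1 (ABC.points j) = 2 := by have := htwo j; omega
    rw [hangle, h, h1]; push_cast; ring
  by_cases hall : ∀ j, cnt T 0 (ABC.points j) = 1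
  · exact Or.inl (equilateral_of_angles fun j => hone j (hall j))
  right
  have hperm : ∃ σ : Equiv.Perm (Fin 3), cnt T 0 (ABC.points (σ 0)) = 1 ∧
      cnt T 0 (ABC.points (σ 1)) = 2 ∧ cnt T 0 (ABC.points (σ 2)) = 0 := by
    have hall' : ¬ (cnt T 0 (ABC.points 0) = 1 ∧ cnt T 0 (ABC.points 1) = 1 ∧
        cnt T 0 (ABC.points 2) = 1) := by
      rintro ⟨h0, h1, h2⟩
      exact hall fun j => by fin_cases j <;> assumption
    have h0 := htwo 0
    have h1 := htwo 1
    have h2 := htwo 2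
    rw [Fin.sum_univ_three] at hc0
    have key : ∀ i j k : Fin 3, Function.Injective ![i, j, k] →
        cnt T 0 (ABC.points i) = 1 → cnt T 0 (ABC.points j) = 2 → cnt T 0 (ABC.points k) = 0 →
        ∃ σ : Equiv.Perm (Fin 3), cnt T 0 (ABC.points (σ 0)) = 1 ∧
          cnt T 0 (ABC.points (σ 1)) = 2 ∧ cnt T 0 (ABC.points (σ 2)) = 0 :=
      fun i j k hinj hi hj hk =>
        ⟨Equiv.ofBijective _ (Finite.injective_iff_bijective.1 hinj), hi, hj, hk⟩
    rcases (by omega : cnt T 0 (ABC.points 0) = 0 ∨ cnt T 0 (ABC.points 0) = 1 ∨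
      cnt T 0 (ABC.points 0) = 2) with h | h | h <;>
    rcases (by omega : cnt T 0 (ABC.points 1) = 0 ∨ cnt T 0 (ABC.points 1) = 1 ∨
      cnt T 0 (ABC.points 1) = 2) with h' | h' | h' <;>
    first
    | omega
    | exact key 0 1 2 (by decide) (by omega) (by omega) (by omega)
    | exact key 0 2 1 (by decide) (by omega) (by omega) (by omega)
    | exact key 1 0 2 (by decide) (by omega) (by omega) (by omega)
    | exact key 1 2 0 (by decide) (by omega) (by omega) (by omega)
    | exact key 2 0 1 (by decide) (by omega) (by omega) (by omega)
    | exact key 2 1 0 (by decide) (by omega) (by omega) (by omega)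
  obtain ⟨σ, h0, h1, h2⟩ := hperm
  exact ⟨σ, hone _ h0, htwo' _ h1, hzero _ h2⟩

end TriangleTiling

end

theorem theorem3p6 (ABC R : TriangleTiling.Tri) (α β : ℝ)
    (hα : TriangleTiling.vertexAngle R 0 = α)
    (hβ : TriangleTiling.vertexAngle R 1 = β)
    (hγ : TriangleTiling.vertexAngle R 2 = 2 * Real.pi / 3)
    (hR : ¬ TriangleTiling.CommensurableAngles R)
    (N : ℕ) (T : Fin N → TriangleTiling.Tri) (hT : TriangleTiling.IsTiling ABC R T)
    (hsim : ¬ TriangleTiling.IsSimilarTo ABC R) :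
    TriangleTiling.CommensurableSides R ∨
      (TriangleTiling.BoundaryAllC ABC T ∧
        (ABC.Equilateral ∨
          TriangleTiling.HasAngles ABC (Real.pi / 3) (2 * α) (2 * β))) := by
  subst hα hβ
  have hirr := TriangleTiling.isIrrationalTile hγ hR
  by_cases hcomm : TriangleTiling.CommensurableSides R
  · exact Or.inl hcomm
  · right
    obtain ⟨x, hx⟩ := TriangleTiling.exists_free hcomm
    obtain rfl : x = 2 := by
      by_contra hne
      exact hT.not_free hirr hsim hne hx
    exact ⟨hT.boundaryAllC hirr hsim hx, hT.shape hirr hsim hx⟩
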